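/- Let $n\ge 0$, $k\ge 0$, and fix an inner product on $\mathbb R^n$ and an orthonormal basis $e_1,\dots,e_n$. *Chains.* A Dirac $k$-chain is a finite formal sum $A=\sum_i(p_i;\alpha_i)$ with $p_i\in\mathbb R^n$, $\alpha_i\in\Lambda_k(\mathbb R^n)$. Let $T_u(p;\alpha)=(p+u;\alpha)$, $\Delta_u=T_u-I$, and for $\sigma=(u_1,\dots,u_j)$ let $\Delta_\sigma=\Delta_{u_1}\cdots\Delta_{u_j}$, $\|\sigma\|=\|u_1\|\cdots\|u_j\|$. Let $\|\alpha\|$ be the mass of $\alpha$, i.e. the infimum of $\sum_j\|\beta_j\|$ over decompositions $\alpha=\sum_j\beta_j$ into simple $k$-vectors, where $\|v_1\wedge\dots\wedge v_k\|=\sqrt{\det\langle v_i,v_j\rangle}$. Put $$\|A\|_{B^r}=\inf\Big\{\sum_i\|\sigma_i\|\|\alpha_i\| : A=\sum_i\Delta_{\sigma_i}(p_i;\alpha_i),\ \sigma_i \text{ of length } \le r\Big\},$$ let $\hat{\mathcal B}_k^r(\mathbb R^n)$ be the completion of the Dirac $k$-chains in this norm ($0\le r<\infty$), and $\hat{\mathcal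 B}_k^\infty(\mathbb R^n)=\varinjlim_r\hat{\mathcal B}_k^r(\mathbb R^n)$. *Forms.* $\mathcal B_k^r(\mathbb R^n)$, $0\le r\le\infty$, is the space of $k$-forms $\omega$ with $\sup\{|\omega(\Delta_\sigma(p;\alpha))| : \sigma \text{ of length } j,\ \|\sigma\|\|\alpha\|=1\}<\infty$ for every finite $j\le r$. The integral $\int_J\omega$ is the continuous extension of $\omega(A)=\sum_i\omega(p_i;\alpha_i)$ from Dirac chains to $J\in\hat{\mathcal B}_k^r(\mathbb R^n)$; for $r=\infty$ it is induced on the inductive limit. *Operators.* On Dirac chains let $E_v(p;\alpha)=(p;v\wedge\alpha)$, $E_v^\dagger(p;v_1\wedge\dots\wedge v_k)=\sum_i(-1)^{i+1}\langle v,v_i\rangle(p;v_1\wedge\cdots\widehat{v_i}\cdots\wedge v_k)$, $P_vA=\lim_{t\to0}(T_{tv}A-A)/t$, all extended continuously to chains ($P_v$ from class $B^r$ to class $B^{r+1}$ for $r\ge1$). Let $$\partial=\sum_iP_{e_i}E_{e_i}^\dagger,\quad \perp=C_{e_n}\circ\dots\circ C_{e_1}\ (C_v=E_v+E_v^\dagger),\quad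 \lozenge=\perp\partial\perp,\quad \square=\lozenge\partial+\partial\lozenge .$$ On forms let $d$ be the exterior derivative, $(\star\omega)(p;\alpha)=\omega(p;\perp\alpha)$, $\delta=\star d\star$ and $\Delta=d\delta+\delta d$. **Theorem (higher order divergence theorem).** Let $s\ge0$ and $1\le r\le\infty$ (or $r=s=0$). For all $J\in\hat{\mathcal B}_k^r(\mathbb R^n)$ and $\omega\in\mathcal B_k^{r+2s}(\mathbb R^n)$ one has $\square^sJ\in\hat{\mathcal B}_k^{r+2s}(\mathbb R^n)$, $\Delta^s\omega\in\mathcal B_k^r(\mathbb R^n)$, and $$\int_{\square^sJ}\omega=\int_J\Delta^s\omega .$$ Moreover $\Delta$ is the classical Hodge Laplacian up to a sign depending only on $n$: $\Delta\omega=(-1)^{n(n+1)/2+1}\sum_i\partial^2\omega/\partial x_i^2$ (coefficientwise) for all $\omega\in\mathcal B_k^3(\mathbb R^n)$. -/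

import Mathlib

open Set Filter Topology

noncomputable section

namespace DiffChain

/-! ### Atomic seminorms -/

section Atomic

variable {ι M : Type*} [AddCommGroup M]

/-- The least total weight of a finite decomposition `x = ∑ atom i`, with all atoms taken from
the index set `S`. -/
def atomicNorm (S : Set ι) (atom : ι → M) (w : ι → ℝ) (x : M) : ℝ :=
  sInf {c : ℝ | ∃ l : List ι, (∀ i ∈ l, i ∈ S) ∧ (l.map atom).sum = x ∧ (l.map w).sum = c}

variable {S : Set ι} {atom : ι → M} {w : ι → ℝ}

theorem atomicNorm_bddBelow (hw : ∀ i, 0 ≤ w i) (x : M) :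
    BddBelow {c : ℝ | ∃ l : List ι, (∀ i ∈ l, i ∈ S) ∧ (l.map atom).sum = x ∧
      (l.map w).sum = c} := by
  refine ⟨0, ?_⟩
  rintro c ⟨l, -, -, rfl⟩
  refine List.sum_nonneg fun a ha => ?_
  obtain ⟨i, -, rfl⟩ := List.mem_map.1 ha
  exact hw i

theorem atomicNorm_le (hw : ∀ i, 0 ≤ w i) (l : List ι) (hl : ∀ i ∈ l, i ∈ S) :
    atomicNorm S atom w (l.map atom).sum ≤ (l.map w).sum :=
  csInf_le (atomicNorm_bddBelow hw _) ⟨l, hl, rfl, rfl⟩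

theorem atomicNorm_nonneg (hw : ∀ i, 0 ≤ w i) (x : M) : 0 ≤ atomicNorm S atom w x := by
  refine Real.sInf_nonneg ?_
  rintro c ⟨l, -, -, rfl⟩
  refine List.sum_nonneg fun a ha => ?_
  obtain ⟨i, -, rfl⟩ := List.mem_map.1 ha
  exact hw i

theorem exists_lt_of_atomicNorm_lt
    (hS : ∀ x : M, ∃ l : List ι, (∀ i ∈ l, i ∈ S) ∧ (l.map atom).sum = x) (x : M) {e : ℝ}
    (he : atomicNorm S atom w x < e) :
    ∃ l : List ι, (∀ i ∈ l, i ∈ S) ∧ (l.map atom).sum = x ∧ (l.map w).sum < e := by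
  obtain ⟨l₀, h₀, h₀'⟩ := hS x
  obtain ⟨c, ⟨l, hl, hx, rfl⟩, hc⟩ := exists_lt_of_csInf_lt
    (s := {c : ℝ | ∃ l : List ι, (∀ i ∈ l, i ∈ S) ∧ (l.map atom).sum = x ∧ (l.map w).sum = c})
    ⟨_, l₀, h₀, h₀', rfl⟩ he
  exact ⟨l, hl, hx, hc⟩

/-- `atomicNorm` is a seminorm, if the atoms generate and are stable under real multiples. -/
def atomicSeminorm [Module ℝ M] (S : Set ι) (atom : ι → M) (w : ι → ℝ) (hw : ∀ i, 0 ≤ w i)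
    (hS : ∀ x : M, ∃ l : List ι, (∀ i ∈ l, i ∈ S) ∧ (l.map atom).sum = x)
    (hc : ∀ (a : ℝ) (i : ι), i ∈ S → ∃ j ∈ S, atom j = a • atom i ∧ w j = |a| * w i) :
    Seminorm ℝ M :=
  Seminorm.ofSMulLE (atomicNorm S atom w)
    (le_antisymm (by simpa using atomicNorm_le (S := S) (atom := atom) hw [] (by simp))
      (atomicNorm_nonneg hw 0))
    (by
      intro x y
      refine le_of_forall_pos_le_add fun e he => ?_
      obtain ⟨l, hl, hx, hlt⟩ := exists_lt_of_atomicNorm_lt (w := w) hS x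
        (lt_add_of_pos_right _ (half_pos he))
      obtain ⟨m, hm, hy, hmt⟩ := exists_lt_of_atomicNorm_lt (w := w) hS y
        (lt_add_of_pos_right _ (half_pos he))
      have h := atomicNorm_le (S := S) (atom := atom) hw (l ++ m) (by
        intro i hi
        rcases List.mem_append.1 hi with h | h
        exacts [hl i h, hm i h])
      simp only [List.map_append, List.sum_append, hx, hy] at h
      linarith)
    (by
      intro a x
      choose! f hf using hc a
      refine le_of_forall_pos_le_add fun e he => ?_
      have hpos : 0 < |a| + 1 := by positivity
      obtain ⟨l, hl, hx, hlt⟩ := exists_lt_of_atomicNorm_lt (w := w) hS x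
        (lt_add_of_pos_right _ (div_pos he hpos))
      have h := atomicNorm_le (S := S) (atom := atom) hw (l.map f) (by
        intro i hi
        obtain ⟨j, hj, rfl⟩ := List.mem_map.1 hi
        exact (hf j (hl j hj)).1)
      have h1 : ((l.map f).map atom).sum = a • x := by
        rw [← hx, List.smul_sum, List.map_map, List.map_map]
        congr 1
        exact List.map_congr_left fun i hi => (hf i (hl i hi)).2.1
      have h2 : ((l.map f).map w).sum = |a| * (l.map w).sum := by
        rw [List.map_map, ← List.sum_map_mul_left]
        congr 1
        exact List.map_congr_left fun i hi => (hf i (hl i hi)).2.2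
      rw [h1, h2] at h
      rw [Real.norm_eq_abs]
      have h3 : |a| * (l.map w).sum ≤ |a| * (atomicNorm S atom w x + e / (|a| + 1)) :=
        mul_le_mul_of_nonneg_left hlt.le (abs_nonneg a)
      have h4 : |a| * (e / (|a| + 1)) ≤ e := by
        rw [mul_div_assoc', div_le_iff₀ hpos]
        nlinarith [abs_nonneg a]
      linarith [mul_add |a| (atomicNorm S atom w x) (e / (|a| + 1))])

end Atomic

variable {V : Type*} [NormedAddCommGroup V] [InnerProductSpace ℝ V] {n : ℕ}

/-! ### Mass of multivectors -/

variable (V) in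
/-- A scalar multiple `c v₁ ∧ ⋯ ∧ v_m` of a wedge product of vectors. -/
structure Simple where
  c : ℝ
  m : ℕ
  v : Fin m → V

/-- The multivector `c v₁ ∧ ⋯ ∧ v_m`. -/
def Simple.vec (a : Simple V) : ExteriorAlgebra ℝ V := a.c • ExteriorAlgebra.ιMulti ℝ a.m a.v

/-- The norm `√⟨α, α⟩` of a simple multivector, where
`⟨u₁ ∧ ⋯ ∧ u_m, v₁ ∧ ⋯ ∧ v_m⟩ = det ⟨u_i, v_j⟩`. -/
def Simple.norm (a : Simple V) : ℝ :=
  |a.c| * √(Matrix.of fun i j => inner ℝ (a.v i) (a.v j)).det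

theorem Simple.norm_nonneg (a : Simple V) : 0 ≤ a.norm := by unfold Simple.norm; positivity

theorem Simple.generate (x : ExteriorAlgebra ℝ V) :
    ∃ l : List (Simple V), (∀ i ∈ l, i ∈ (univ : Set (Simple V))) ∧
      (l.map Simple.vec).sum = x := by
  have hx : x ∈ Submodule.span ℝ (Set.range fun y : Σ m, (Fin m → V) =>
      ExteriorAlgebra.ιMulti ℝ y.1 y.2) := by
    rw [ExteriorAlgebra.ιMulti_span]; trivial
  induction hx using Submodule.span_induction with
  | mem y hy =>
    obtain ⟨⟨m, v⟩, rfl⟩ := hy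
    exact ⟨[⟨1, m, v⟩], by simp, by simp [Simple.vec]⟩
  | zero => exact ⟨[], by simp, by simp⟩
  | add y z _ _ hy hz =>
    obtain ⟨l, -, rfl⟩ := hy
    obtain ⟨m, -, rfl⟩ := hz
    exact ⟨l ++ m, by simp, by simp⟩
  | smul a y _ hy =>
    obtain ⟨l, -, rfl⟩ := hy
    refine ⟨l.map fun b => ⟨a * b.c, b.m, b.v⟩, by simp, ?_⟩
    rw [List.smul_sum, List.map_map, List.map_map]
    congr 1
    exact List.map_congr_left fun b _ => by simp [Simple.vec, mul_smul]

variable (V) in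
/-- The mass of a multivector: the least total norm of the simple multivectors in a decomposition
of it. Projecting a decomposition onto one degree drops summands, so that for a `k`-vector it does
not matter whether the summands are required to be `k`-vectors. -/
def mass : Seminorm ℝ (ExteriorAlgebra ℝ V) :=
  atomicSeminorm univ Simple.vec Simple.norm Simple.norm_nonneg Simple.generate (by
    intro a i _
    exact ⟨⟨a * i.c, i.m, i.v⟩, trivial, by simp [Simple.vec, mul_smul],
      by simp [Simple.norm, abs_mul, mul_assoc]⟩)

/-! ### Dirac chains and the `B^r` norms -/

variable (V) in
/-- Dirac chains `∑ (p_i; α_i)`, of all dimensions together: finitely supported functions from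
points to multivectors. -/
abbrev Dirac : Type _ := V →₀ ExteriorAlgebra ℝ V

variable (V) in
/-- The Dirac `k`-chains. -/
def diracDeg (k : ℕ) : Set (Dirac V) := {A | ∀ p, A p ∈ ⋀[ℝ]^k V}

/-- Translation `T_u (p; α) = (p + u; α)`. -/
def transl (u : V) : Dirac V →ₗ[ℝ] Dirac V :=
  Finsupp.lmapDomain (ExteriorAlgebra ℝ V) ℝ fun p => p + u

/-- `Δ_u = T_u - I`. -/
def diff (u : V) : Dirac V →ₗ[ℝ] Dirac V := transl u - LinearMap.id

/-- `Δ_σ = Δ_{u₁} ∘ ⋯ ∘ Δ_{u_j}` for `σ = [u₁, …, u_j]`. -/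
def diffs : List V → Dirac V →ₗ[ℝ] Dirac V
  | [] => LinearMap.id
  | u :: σ => diff u ∘ₗ diffs σ

variable (V) in
/-- The data `σ`, `p`, `α` of a difference chain `Δ_σ (p; α)`. -/
structure DiffElt where
  σ : List V
  p : V
  α : ExteriorAlgebra ℝ V

/-- The difference chain `Δ_σ (p; α)`. -/
def DiffElt.chain (d : DiffElt V) : Dirac V := diffs d.σ (Finsupp.single d.p d.α)

/-- `‖σ‖ ‖α‖`, with `‖σ‖ = ‖u₁‖ ⋯ ‖u_j‖` and `‖α‖` the mass. -/
def DiffElt.cost (d : DiffElt V) : ℝ := (d.σ.map fun u => ‖u‖).prod * mass V d.α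

theorem DiffElt.cost_nonneg (d : DiffElt V) : 0 ≤ d.cost := by
  refine mul_nonneg (List.prod_nonneg fun a ha => ?_) (apply_nonneg _ _)
  obtain ⟨u, -, rfl⟩ := List.mem_map.1 ha
  exact norm_nonneg u

theorem DiffElt.generate (r : ℕ) (A : Dirac V) :
    ∃ l : List (DiffElt V), (∀ d ∈ l, d ∈ {d : DiffElt V | d.σ.length ≤ r}) ∧
      (l.map DiffElt.chain).sum = A := by
  induction A using Finsupp.induction_linear with
  | zero => exact ⟨[], by simp, by simp⟩
  | add A B hA hB =>
    obtain ⟨l, hl, rfl⟩ := hA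
    obtain ⟨m, hm, rfl⟩ := hB
    refine ⟨l ++ m, fun d hd => ?_, by simp⟩
    rcases List.mem_append.1 hd with h | h
    exacts [hl d h, hm d h]
  | single p α => exact ⟨[⟨[], p, α⟩], by simp, by simp [DiffElt.chain, diffs]⟩

variable (V) in
/-- The norm `‖A‖_{B^r}`: the least total cost of a decomposition of `A` into `j`-difference
chains with `j ≤ r`. On Dirac `k`-chains it does not matter whether the pieces are required to be
`k`-chains, since projecting onto one degree does not raise the cost. -/
def bNorm (r : ℕ) : Seminorm ℝ (Dirac V) :=
  atomicSeminorm {d : DiffElt V | d.σ.length ≤ r} DiffElt.chain DiffElt.cost DiffElt.cost_nonneg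
    (DiffElt.generate r) (by
      intro a d hd
      refine ⟨⟨d.σ, d.p, a • d.α⟩, hd, ?_, ?_⟩
      · simp only [DiffElt.chain]
        rw [← Finsupp.smul_single, map_smul]
      · simp only [DiffElt.cost]
        rw [map_smul_eq_mul, Real.norm_eq_abs]
        ring)

theorem bNorm_anti {r s : ℕ} (h : r ≤ s) (A : Dirac V) : bNorm V s A ≤ bNorm V r A := by
  refine csInf_le_csInf (atomicNorm_bddBelow DiffElt.cost_nonneg A) ?_ ?_
  · obtain ⟨l, hl, hA⟩ := DiffElt.generate r A
    exact ⟨_, l, hl, hA, rfl⟩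
  · rintro c ⟨l, hl, hA, hc⟩
    exact ⟨l, fun d hd => le_trans (hl d hd) h, hA, hc⟩

variable (V) in
/-- Dirac chains, as a space normed by `‖·‖_{B^r}`. -/
def DiracB (_r : ℕ) : Type _ := Dirac V

instance (r : ℕ) : AddCommGroup (DiracB V r) := inferInstanceAs (AddCommGroup (Dirac V))

instance (r : ℕ) : Module ℝ (DiracB V r) := inferInstanceAs (Module ℝ (Dirac V))

instance (r : ℕ) : SeminormedAddCommGroup (DiracB V r) :=
  AddGroupSeminorm.toSeminormedAddCommGroup (E := DiracB V r) (bNorm V r).toAddGroupSeminorm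

instance (r : ℕ) : NormedSpace ℝ (DiracB V r) where
  norm_smul_le a A := (map_smul_eq_mul (bNorm V r) a A).le

/-! ### Differential chains -/

variable (V) in
/-- Differential chains of class `B^r` of all dimensions together: the completion of the Dirac
chains in the `B^r` norm. -/
abbrev Chain (r : ℕ) : Type _ := UniformSpace.Completion (DiracB V r)

/-- A Dirac chain as a chain of class `B^r`. -/
def ofDirac (r : ℕ) (A : Dirac V) : Chain V r := ((show DiracB V r from A : DiracB V r) : Chain V r)

variable (V) in
/-- The differential `k`-chains of class `B^r`: the closure of the Dirac `k`-chains, which is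
their completion. -/
def chainDeg (k r : ℕ) : Set (Chain V r) := closure (ofDirac r '' diracDeg V k)

variable (V) in
/-- The identity from the `B^r` norm to the `B^s` norm. -/
def diracLink (r s : ℕ) (h : r ≤ s) : DiracB V r →L[ℝ] DiracB V s :=
  LinearMap.mkContinuous
    { toFun := fun A => (show Dirac V from A)
      map_add' := fun _ _ => rfl
      map_smul' := fun _ _ => rfl } 1
    (fun A => by rw [one_mul]; exact bNorm_anti h A)

variable (V) in
/-- The linking maps. -/
def link (r s : ℕ) (h : r ≤ s) : Chain V r →ₗ[ℝ] Chain V s :=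
  ((diracLink V r s h).completion : Chain V r →L[ℝ] Chain V s).toLinearMap

variable (V) in
/-- Differential chains of class `B^∞`: the inductive limit of the spaces of chains of class
`B^r` along the linking maps. -/
abbrev ChainInf : Type _ := Module.DirectLimit (Chain V) (link V)

variable (V) in
/-- The canonical map into the inductive limit. -/
def toInf (r : ℕ) : Chain V r →ₗ[ℝ] ChainInf V := Module.DirectLimit.of ℝ ℕ (Chain V) (link V) r

variable (V) in
/-- The differential `k`-chains of class `B^∞`. -/
def chainInfDeg (k : ℕ) : Set (ChainInf V) := ⋃ r, toInf V r '' chainDeg V k r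

theorem exists_rep (J : ChainInf V) : ∃ x : Σ r : ℕ, Chain V (r + 1), toInf V (x.1 + 1) x.2 = J := by
  obtain ⟨r, K, rfl⟩ := Module.DirectLimit.exists_of J
  exact ⟨⟨r, link V r (r + 1) r.le_succ K⟩, Module.DirectLimit.of_f⟩

/-- A representative, of some finite class `B^r` with `r ≥ 1`, of a chain of class `B^∞`. -/
def rep (J : ChainInf V) : Σ r : ℕ, Chain V (r + 1) := (exists_rep J).choose

/-! ### Primitive operators -/

/-- Extrusion of multivectors, `α ↦ v ∧ α`. -/
def extVec (v : V) : ExteriorAlgebra ℝ V →ₗ[ℝ] ExteriorAlgebra ℝ V :=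
  LinearMap.mulLeft ℝ (ExteriorAlgebra.ι ℝ v)

/-- Retraction of multivectors,
`v₁ ∧ ⋯ ∧ v_k ↦ ∑ (-1)^(i+1) ⟨v, v_i⟩ v₁ ∧ ⋯ (no v_i) ⋯ ∧ v_k`. -/
def retVec (v : V) : ExteriorAlgebra ℝ V →ₗ[ℝ] ExteriorAlgebra ℝ V :=
  CliffordAlgebra.contractLeft (innerₗ V v)

/-- The pointwise action `(p; α) ↦ (p; f α)` on Dirac chains. -/
def pointwise (f : ExteriorAlgebra ℝ V →ₗ[ℝ] ExteriorAlgebra ℝ V) : Dirac V →ₗ[ℝ] Dirac V :=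
  Finsupp.mapRange.linearMap f

/-- The continuous extension of the pointwise action to chains of class `B^r`. -/
def pointwiseChain (f : ExteriorAlgebra ℝ V →ₗ[ℝ] ExteriorAlgebra ℝ V) (r : ℕ) :
    Chain V r → Chain V r :=
  UniformSpace.Completion.map fun A : DiracB V r => (show DiracB V r from pointwise f A)

/-- Extrusion `E_v`. -/
def extrude (v : V) {r : ℕ} (J : Chain V r) : Chain V r := pointwiseChain (extVec v) r J

/-- Retraction `E_v†`. -/
def retract (v : V) {r : ℕ} (J : Chain V r) : Chain V r := pointwiseChain (retVec v) r J

/-- The prederivative `lim_{t → 0} (T_{tv} A - A) / t` of a Dirac chain, in the `B^(r+1)` norm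
(where the limit exists as soon as `r ≥ 1`). -/
def preDirac (v : V) (r : ℕ) (A : Dirac V) : Chain V (r + 1) :=
  limUnder (𝓝[≠] (0 : ℝ)) fun t => ofDirac (r + 1) (t⁻¹ • (transl (t • v) A - A))

/-- The prederivative `P_v`, from chains of class `B^r` to chains of class `B^(r+1)`: the
continuous extension from Dirac chains (`r ≥ 1`). -/
def prederiv (v : V) {r : ℕ} : Chain V r → Chain V (r + 1) :=
  UniformSpace.Completion.extension fun A : DiracB V r => preDirac v r (show Dirac V from A)

/-! ### Boundary, perpendicular complement, geometric Laplace operator -/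

/-- Boundary `∂ = ∑ P_{e_i} E_{e_i}†`. -/
def bdry (b : OrthonormalBasis (Fin n) ℝ V) {r : ℕ} (J : Chain V r) : Chain V (r + 1) :=
  ∑ i, prederiv (b i) (retract (b i) J)

/-- Perpendicular complement `⊥ = C_{e_n} ∘ ⋯ ∘ C_{e_1}` with `C_v = E_v + E_v†`. -/
def perp (b : OrthonormalBasis (Fin n) ℝ V) {r : ℕ} (J : Chain V r) : Chain V r :=
  (List.ofFn b).foldl (fun K v => extrude v K + retract v K) J

/-- Coboundary `◇ = ⊥ ∂ ⊥`. -/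
def cobdry (b : OrthonormalBasis (Fin n) ℝ V) {r : ℕ} (J : Chain V r) : Chain V (r + 1) :=
  perp b (bdry b (perp b J))

/-- The geometric Laplace operator `□ = ◇ ∂ + ∂ ◇`. -/
def box (b : OrthonormalBasis (Fin n) ℝ V) {r : ℕ} (J : Chain V r) : Chain V (r + 2) :=
  cobdry b (bdry b J) + bdry b (cobdry b J)

/-- The powers `□^s`. -/
def boxPow (b : OrthonormalBasis (Fin n) ℝ V) {r : ℕ} : (s : ℕ) → Chain V r → Chain V (r + 2 * s)
  | 0, J => J
  | s + 1, J => box b (boxPow b s J)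

/-- The operator `□` induced on the inductive limit: `□` of the class of `K` is the class of `□ K`
(which does not depend on the representative `K`, as `□` commutes with the linking maps). -/
def boxInf (b : OrthonormalBasis (Fin n) ℝ V) (J : ChainInf V) : ChainInf V :=
  toInf V ((rep J).1 + 1 + 2) (box b (rep J).2)

/-! ### Differential forms and integration -/

variable (V) in
/-- Differential forms of all degrees together. -/
abbrev Form : Type _ := ∀ k : ℕ, V → V [⋀^Fin k]→L[ℝ] ℝ

/-- The value `ω(p; α)`. -/
def Form.val (ω : Form V) (p : V) : ExteriorAlgebra ℝ V →ₗ[ℝ] ℝ :=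
  ExteriorAlgebra.liftAlternating fun k => (ω k p).toAlternatingMap

/-- The value `ω(A) = ∑ ω(p_i; α_i)` on a Dirac chain. -/
def Form.eval (ω : Form V) : Dirac V →ₗ[ℝ] ℝ := Finsupp.lsum ℝ fun p => ω.val p

variable (V) in
/-- The `k`-forms of class `B^r`, `0 ≤ r ≤ ∞`: the `k`-forms for which
`|ω|_{B^j} = sup {|ω(Δ_σ (p; α))| : σ = [u₁, …, u_j], ‖σ‖ ‖α‖ = 1}` is finite for all finite
`j ≤ r`. -/
def formDeg (k : ℕ) (r : ℕ∞) : Set (Form V) :=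
  {ω | (∀ j, j ≠ k → ω j = 0) ∧
    ∀ j : ℕ, (j : ℕ∞) ≤ r → ∃ C : ℝ, ∀ d : DiffElt V, d.σ.length = j →
      |ω.eval d.chain| ≤ C * d.cost}

/-- The integral of a form over a chain of class `B^r`: the continuous extension of `A ↦ ω(A)`
from Dirac chains. -/
def integral {r : ℕ} (J : Chain V r) (ω : Form V) : ℝ :=
  UniformSpace.Completion.extension (fun A : DiracB V r => ω.eval (show Dirac V from A)) J

/-- The integral of a form of class `B^∞` over a chain of class `B^∞`: the integral over any
representative. -/
def integralInf (J : ChainInf V) (ω : Form V) : ℝ := integral (rep J).2 ω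

/-- The exterior derivative. -/
def Form.d (ω : Form V) : Form V
  | 0 => 0
  | k + 1 => extDeriv (ω k)

/-- Perpendicular complement `C_{e_n} ∘ ⋯ ∘ C_{e_1}` on multivectors. -/
def perpVec (b : OrthonormalBasis (Fin n) ℝ V) : ExteriorAlgebra ℝ V →ₗ[ℝ] ExteriorAlgebra ℝ V :=
  (List.ofFn b).foldl (fun f v => (extVec v + retVec v) ∘ₗ f) LinearMap.id

theorem continuous_alternating (b : OrthonormalBasis (Fin n) ℝ V) {k : ℕ} (f : V [⋀^Fin k]→ₗ[ℝ] ℝ) :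
    Continuous f := by
  have h : ∀ v : Fin k → V, f v =
      ∑ q : Fin k → Fin n, (∏ i, inner ℝ (b (q i)) (v i)) * f fun i => b (q i) := by
    intro v
    have h1 : v = fun i => ∑ j, (inner ℝ (b j) (v i) : ℝ) • b j := by
      funext i
      exact (b.sum_repr' (v i)).symm
    conv_lhs => rw [h1]
    have h2 := f.toMultilinearMap.map_sum (fun i j => (inner ℝ (b j) (v i) : ℝ) • b j)
    refine h2.trans (Finset.sum_congr rfl fun q _ => ?_)
    exact f.toMultilinearMap.map_smul_univ (fun i => (inner ℝ (b (q i)) (v i) : ℝ)) fun i => b (q i)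
  rw [show (f : (Fin k → V) → ℝ) = _ from funext h]
  fun_prop

/-- The star operator on forms, `(⋆ω)(p; α) = ω(p; ⊥α)`. -/
def Form.star (b : OrthonormalBasis (Fin n) ℝ V) (ω : Form V) : Form V := fun k p =>
  { (ω.val p ∘ₗ perpVec b).compAlternatingMap (ExteriorAlgebra.ιMulti ℝ k) with
    cont := continuous_alternating b
      ((ω.val p ∘ₗ perpVec b).compAlternatingMap (ExteriorAlgebra.ιMulti ℝ k)) }

/-- The codifferential `δ = ⋆ d ⋆`. -/
def Form.codiff (b : OrthonormalBasis (Fin n) ℝ V) (ω : Form V) : Form V :=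
  ((ω.star b).d).star b

/-- The Laplace operator `Δ = d δ + δ d`. -/
def Form.lap (b : OrthonormalBasis (Fin n) ℝ V) (ω : Form V) : Form V :=
  (ω.codiff b).d + (ω.d).codiff b

end DiffChain

end

noncomputable section

namespace DiffChain

/-! ### Hyers–Ulam linearisation, and bounds read off on atoms and simple multivectors. -/

section AtomBounds

/-! ### Almost additive maps -/

section AlmostAdditive

variable {E F : Type*} [NormedAddCommGroup E] [NormedSpace ℝ E] [NormedAddCommGroup F]
  [NormedSpace ℝ F]

/-! The theorem is a duality statement plus one Clifford computation. Every operator on chains is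
built from two kinds: pointwise actions `(p; α) ↦ (p; f α)` and prederivatives `P_v`. Each is
bounded in the appropriate norms on Dirac chains, so it extends by continuity, and an identity
between continuous maps need only be checked on Dirac chains (`chain_ext`). A form of class `B^r` is
a form whose evaluation is a bounded functional for the `B^r` norm (`Form.isB_iff`), so integration
extends as well.

The analytic input is `P_v`. By `diff_add`, the failure of `u ↦ Δ_u A` to be additive is the second
difference `Δ_u Δ_w A`, whose `B^(r+2)` norm is at most `‖u‖ ‖w‖ ‖A‖_{B^r}`. A map that is additive
up to such an error is linear up to a quadratic one (`exists_clm_of_almost_additive`); this gives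
the existence of the limit and its bound. The same lemma, applied to `u ↦ ω(p + u) - ω(p)`, makes
forms of class `B^2` differentiable, and `P_v` becomes dual to the directional derivative
(`integral_prederivL`). Expanding in an orthonormal basis then gives Stokes' theorem
`integral_bdry`; with `integral_perp` it yields `integral_cobdry` and `integral_box`. Induction on
`s` finishes the finite classes, and compatibility with the linking maps carries everything to the
inductive limit.

For the sign, conjugating `E_{e_i}†` by the Clifford product `⊥` gives `lapSign n` times `E_{e_i}`
(`perpVec_conj_retVec`). Hence `◇` is a signed sum of `P_{e_i} E_{e_i}`, and the anticommutation
relations together with `P_v P_w = P_w P_v` collapse `□` to a signed sum of `P_{e_i}²` (`box_eq`).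
Duality transfers this to forms (`Form.lap_eq`). It also shows at once that both Laplacians preserve
degree. -/

theorem norm_scaled_sub_le {G : E → F} {K : ℝ}
    (h : ∀ u w, ‖G (u + w) - G u - G w‖ ≤ K * (‖u‖ * ‖w‖)) (u : E) (m : ℕ) :
    dist ((2 : ℝ) ^ m • G (((2 : ℝ) ^ m)⁻¹ • u))
      ((2 : ℝ) ^ (m + 1) • G (((2 : ℝ) ^ (m + 1))⁻¹ • u)) ≤ K * ‖u‖ ^ 2 / 2 / 2 / 2 ^ m := by
  have h2 : ((2 : ℝ) ^ m)⁻¹ • u = ((2 : ℝ) ^ (m + 1))⁻¹ • u + ((2 : ℝ) ^ (m + 1))⁻¹ • u := by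
    rw [← add_smul]
    congr 1
    rw [pow_succ]
    field_simp
    norm_num
  have h3 := h (((2 : ℝ) ^ (m + 1))⁻¹ • u) (((2 : ℝ) ^ (m + 1))⁻¹ • u)
  rw [← h2] at h3
  have hp : (0 : ℝ) < 2 ^ m := by positivity
  rw [dist_eq_norm]
  have h4 : (2 : ℝ) ^ m • G (((2 : ℝ) ^ m)⁻¹ • u) -
      (2 : ℝ) ^ (m + 1) • G (((2 : ℝ) ^ (m + 1))⁻¹ • u) = (2 : ℝ) ^ m •
      (G (((2 : ℝ) ^ m)⁻¹ • u) - G (((2 : ℝ) ^ (m + 1))⁻¹ • u) -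
        G (((2 : ℝ) ^ (m + 1))⁻¹ • u)) := by
    rw [pow_succ]
    module
  rw [h4, norm_smul, Real.norm_of_nonneg hp.le]
  -- The value is `K‖u‖²/4` divided by `2^m`. It is displayed as `C / 2 / 2^m` with `C = K‖u‖²/2` to
  -- match the hypothesis of the geometric-series lemmas.
  refine (mul_le_mul_of_nonneg_left h3 hp.le).trans (le_of_eq ?_)
  rw [norm_smul, norm_inv, norm_pow, Real.norm_two, pow_succ]
  field_simp

/-- A Lipschitz-at-zero map whose deviation from additivity is quadratic is, up to a quadratic
error, a continuous linear map. -/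
theorem exists_clm_of_almost_additive [CompleteSpace F] {G : E → F} {K M : ℝ}
    (h : ∀ u w, ‖G (u + w) - G u - G w‖ ≤ K * (‖u‖ * ‖w‖)) (hM : ∀ u, ‖G u‖ ≤ M * ‖u‖) :
    ∃ L : E →L[ℝ] F, (∀ u, ‖G u - L u‖ ≤ K * ‖u‖ ^ 2) ∧ ∀ u, ‖L u‖ ≤ M * ‖u‖ := by
  set x : E → ℕ → F := fun u m => (2 : ℝ) ^ m • G (((2 : ℝ) ^ m)⁻¹ • u) with hx
  have hd := fun u m => norm_scaled_sub_le h u m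
  have hlim : ∀ u, ∃ a, Tendsto (x u) atTop (𝓝 a) := fun u =>
    cauchySeq_tendsto_of_complete (cauchySeq_of_le_geometric_two (hd u))
  choose L hL using hlim
  have hxM : ∀ u m, ‖x u m‖ ≤ M * ‖u‖ := by
    intro u m
    have hp : (0 : ℝ) < 2 ^ m := by positivity
    simp only [hx]
    rw [norm_smul, Real.norm_of_nonneg hp.le]
    refine (mul_le_mul_of_nonneg_left (hM _) hp.le).trans (le_of_eq ?_)
    rw [norm_smul, norm_inv, norm_pow, Real.norm_two]
    field_simp
  have hLM : ∀ u, ‖L u‖ ≤ M * ‖u‖ := fun u =>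
    le_of_tendsto (hL u).norm (Eventually.of_forall fun m => hxM u m)
  have hadd : ∀ u w, L (u + w) = L u + L w := by
    intro u w
    have h1 : Tendsto (fun m => x (u + w) m - x u m - x w m) atTop (𝓝 (L (u + w) - L u - L w)) :=
      ((hL _).sub (hL _)).sub (hL _)
    have h2 : Tendsto (fun m : ℕ => K * (‖u‖ * ‖w‖) * ((2 : ℝ)⁻¹) ^ m) atTop (𝓝 0) := by
      simpa using (tendsto_pow_atTop_nhds_zero_of_lt_one (r := (2 : ℝ)⁻¹) (by norm_num)
        (by norm_num)).const_mul (K * (‖u‖ * ‖w‖))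
    -- Rescaling by `2^m` multiplies a defect that is quadratic in `2^(-m)`, so a factor `2^(-m)`
    -- survives.
    have h3 : Tendsto (fun m => x (u + w) m - x u m - x w m) atTop (𝓝 0) := by
      refine squeeze_zero_norm (fun m => ?_) h2
      have hp : (0 : ℝ) < 2 ^ m := by positivity
      have h4 : x (u + w) m - x u m - x w m = (2 : ℝ) ^ m •
          (G (((2 : ℝ) ^ m)⁻¹ • u + ((2 : ℝ) ^ m)⁻¹ • w) - G (((2 : ℝ) ^ m)⁻¹ • u) -
            G (((2 : ℝ) ^ m)⁻¹ • w)) := by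
        simp only [hx, smul_add, smul_sub]
      rw [h4, norm_smul, Real.norm_of_nonneg hp.le]
      refine (mul_le_mul_of_nonneg_left (h _ _) hp.le).trans (le_of_eq ?_)
      rw [norm_smul, norm_smul, norm_inv, norm_pow, Real.norm_two, inv_pow]
      field_simp
    have h5 := tendsto_nhds_unique h1 h3
    rwa [sub_sub, sub_eq_zero] at h5
  let L' : E →+ F := AddMonoidHom.mk' L hadd
  have hc : Continuous L' := by
    refine AddMonoidHomClass.continuous_of_bound L' M fun u => hLM u
  refine ⟨L'.toRealLinearMap hc, fun u => ?_, fun u => hLM u⟩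
  have h6 := dist_le_of_le_geometric_two_of_tendsto₀ (hd u) (hL u)
  simp only [pow_zero, inv_one, one_smul] at h6
  rw [← dist_eq_norm]
  refine h6.trans ?_
  have : 0 ≤ K * ‖u‖ ^ 2 := by
    have := (norm_nonneg _).trans (h u u)
    rwa [pow_two]
  linarith

end AlmostAdditive

/-! ### Seminorms bounded on atoms -/

/-- By subadditivity, a bound on atoms passes to every decomposition and so to the infimum. Both the
mass and the `B^r` norms are controlled through this principle. -/
theorem le_mul_atomicNorm {ι M : Type*} [AddCommGroup M] [Module ℝ M] {S : Set ι} {atom : ι → M}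
    {w : ι → ℝ}
    (hS : ∀ x : M, ∃ l : List ι, (∀ i ∈ l, i ∈ S) ∧ (l.map atom).sum = x)
    (q : Seminorm ℝ M) {C : ℝ} (hC : 0 ≤ C) (hq : ∀ i ∈ S, q (atom i) ≤ C * w i) (x : M) :
    q x ≤ C * atomicNorm S atom w x := by
  refine le_of_forall_pos_le_add fun e he => ?_
  -- The slack is `e / (C + 1)` rather than `e / C`, so that `C = 0` is allowed.
  have hp : 0 < C + 1 := by positivity
  obtain ⟨l, hl, rfl, hlt⟩ := exists_lt_of_atomicNorm_lt (w := w) hS x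
    (lt_add_of_pos_right _ (div_pos he hp))
  have h1 : q (l.map atom).sum ≤ C * (l.map w).sum := by
    clear hlt
    induction l with
    | nil => simp
    | cons i l ih =>
      simp only [List.map_cons, List.sum_cons, mul_add]
      exact (map_add_le_add q _ _).trans (add_le_add (hq i (hl i (by simp)))
        (ih fun j hj => hl j (by simp [hj])))
  have h2 := mul_le_mul_of_nonneg_left hlt.le hC
  have h3 : C * (e / (C + 1)) ≤ e := by
    rw [mul_div_assoc', div_le_iff₀ hp]
    nlinarith
  linarith [mul_add C (atomicNorm S atom w (l.map atom).sum) (e / (C + 1))]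

variable {V : Type*} [NormedAddCommGroup V] [InnerProductSpace ℝ V]

theorem le_mul_mass (q : Seminorm ℝ (ExteriorAlgebra ℝ V)) {C : ℝ} (hC : 0 ≤ C)
    (hq : ∀ a : Simple V, q a.vec ≤ C * a.norm) (α : ExteriorAlgebra ℝ V) :
    q α ≤ C * mass V α :=
  le_mul_atomicNorm Simple.generate q hC (fun a _ => hq a) α

theorem le_mul_bNorm (r : ℕ) (q : Seminorm ℝ (Dirac V)) {C : ℝ} (hC : 0 ≤ C)
    (hq : ∀ d : DiffElt V, d.σ.length ≤ r → q d.chain ≤ C * d.cost) (A : Dirac V) :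
    q A ≤ C * bNorm V r A :=
  le_mul_atomicNorm (DiffElt.generate r) q hC (fun d hd => hq d hd) A

theorem bNorm_chain_le {r : ℕ} (d : DiffElt V) (hd : d.σ.length ≤ r) :
    bNorm V r d.chain ≤ d.cost := by
  have h := atomicNorm_le (S := {d : DiffElt V | d.σ.length ≤ r}) (atom := DiffElt.chain)
    DiffElt.cost_nonneg [d] (by simpa using hd)
  simp only [List.map_cons, List.map_nil, List.sum_cons, List.sum_nil, add_zero] at h
  exact h

/-! ### Linear maps are bounded with respect to the mass -/

/-- On the span of independent `v`, with orthonormal basis `u`, an alternating `m`-form is a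
multiple of the determinant. If `M` is the matrix of `v` in `u`, then `g v = g(u) det M`, the Gram
matrix is `Mᵀ M`, and `|g(u)| ≤ ‖g‖`. If `v` is dependent, `g v = 0`. -/
theorem abs_alternating_le [FiniteDimensional ℝ V] {m : ℕ} (g : V [⋀^Fin m]→L[ℝ] ℝ)
    (v : Fin m → V) :
    |g v| ≤ ‖g‖ * √(Matrix.of fun i j => inner ℝ (v i) (v j)).det := by
  by_cases hv : LinearIndependent ℝ v
  · set W := Submodule.span ℝ (Set.range v) with hW
    have hfin : Module.finrank ℝ W = m := by
      simpa using finrank_span_eq_card hv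
    let u : OrthonormalBasis (Fin m) ℝ W := (stdOrthonormalBasis ℝ W).reindex (finCongr hfin)
    let v' : Fin m → W := fun i => ⟨v i, Submodule.subset_span ⟨i, rfl⟩⟩
    let f : W [⋀^Fin m]→ₗ[ℝ] ℝ := g.toAlternatingMap.compLinearMap W.subtype
    have hf := congrArg (fun F : W [⋀^Fin m]→ₗ[ℝ] ℝ => F v')
      (AlternatingMap.eq_smul_basis_det u.toBasis f)
    have h1 : f v' = g v := rfl
    have h2 : f u.toBasis = g fun i => (u i : V) := by
      simp [f]
    simp only [AlternatingMap.smul_apply, h1, h2, smul_eq_mul] at hf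
    have h3 : (Matrix.of fun i j => inner ℝ (v i) (v j)) =
        (u.toBasis.toMatrix v').transpose * u.toBasis.toMatrix v' := by
      ext i j
      simp only [Matrix.of_apply, Matrix.mul_apply, Matrix.transpose_apply,
        Module.Basis.toMatrix_apply, OrthonormalBasis.coe_toBasis_repr_apply,
        OrthonormalBasis.repr_apply_apply]
      have := u.sum_inner_mul_inner (v' i) (v' j)
      rw [show inner ℝ (v i) (v j) = inner ℝ (v' i) (v' j) from rfl, ← this]
      exact Finset.sum_congr rfl fun l _ => by rw [real_inner_comm (v' i)]
    rw [h3, Matrix.det_mul, Matrix.det_transpose, Real.sqrt_mul_self_eq_abs, hf, abs_mul]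
    refine mul_le_mul_of_nonneg_right ?_ (abs_nonneg _)
    refine (g.le_opNorm _).trans (le_of_eq ?_)
    have : ∀ i, ‖(u i : V)‖ = 1 := fun i => u.norm_eq_one i
    simp [this]
  · have : g v = 0 := g.toAlternatingMap.map_linearDependent v hv
    rw [this, abs_zero]
    positivity

instance finite_exteriorAlgebra [FiniteDimensional ℝ V] :
    Module.Finite ℝ (ExteriorAlgebra ℝ V) := by
  have h : (⊤ : Submodule ℝ (ExteriorAlgebra ℝ V)) ≤
      ⨆ m : Fin (Module.finrank ℝ V + 1), ⋀[ℝ]^(m : ℕ) V := by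
    rw [← ExteriorAlgebra.ιMulti_span, Submodule.span_le]
    rintro _ ⟨⟨m, v⟩, rfl⟩
    by_cases hm : m < Module.finrank ℝ V + 1
    · refine Submodule.mem_iSup_of_mem (⟨m, hm⟩ : Fin (Module.finrank ℝ V + 1)) ?_
      exact ExteriorAlgebra.ιMulti_range ℝ m ⟨v, rfl⟩
    · have hv : ¬ LinearIndependent ℝ v := fun hv => by
        have := hv.fintype_card_le_finrank
        simp at this
        omega
      simp only [(ExteriorAlgebra.ιMulti ℝ m).map_linearDependent v hv]
      exact Submodule.zero_mem _
  rw [Module.finite_def, eq_top_iff.2 h |>.symm, ← Module.Finite.iff_fg]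
  infer_instance

/-- An alternating map on a finite-dimensional space, as a continuous one. -/
def contAlternating [FiniteDimensional ℝ V] {m : ℕ} (f : V [⋀^Fin m]→ₗ[ℝ] ℝ) :
    V [⋀^Fin m]→L[ℝ] ℝ :=
  { f with cont := continuous_alternating (stdOrthonormalBasis ℝ V) f }

theorem contAlternating_apply [FiniteDimensional ℝ V] {m : ℕ} (f : V [⋀^Fin m]→ₗ[ℝ] ℝ)
    (v : Fin m → V) : contAlternating f v = f v := rfl

/-- Degree by degree this is `abs_alternating_le`. One constant serves all degrees because wedge
products of more than `finrank` vectors vanish. -/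
theorem exists_abs_le_mass [FiniteDimensional ℝ V] (f : ExteriorAlgebra ℝ V →ₗ[ℝ] ℝ) :
    ∃ C : ℝ, 0 ≤ C ∧ ∀ α, |f α| ≤ C * mass V α := by
  let g : ∀ m : ℕ, V [⋀^Fin m]→L[ℝ] ℝ := fun m =>
    contAlternating (f.compAlternatingMap (ExteriorAlgebra.ιMulti ℝ m))
  have hC : 0 ≤ ∑ m ∈ Finset.range (Module.finrank ℝ V + 1), ‖g m‖ :=
    Finset.sum_nonneg fun _ _ => norm_nonneg _
  refine ⟨_, hC, fun α => ?_⟩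
  refine le_mul_mass ((normSeminorm ℝ ℝ).comp f) hC (fun a => ?_) α
  change |f a.vec| ≤ _
  have h1 : f a.vec = a.c * g a.m a.v := by
    simp [Simple.vec, g, contAlternating_apply]
  rw [h1, abs_mul, Simple.norm, mul_left_comm]
  refine mul_le_mul_of_nonneg_left ?_ (abs_nonneg _)
  by_cases hm : a.m < Module.finrank ℝ V + 1
  · refine (abs_alternating_le (g a.m) a.v).trans (mul_le_mul_of_nonneg_right ?_ (by positivity))
    exact Finset.single_le_sum (f := fun m => ‖g m‖) (fun _ _ => norm_nonneg _)
      (Finset.mem_range.2 hm)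
  · have hv : ¬ LinearIndependent ℝ a.v := fun hv => by
      have := hv.fintype_card_le_finrank
      simp at this
      omega
    have : g a.m a.v = 0 := (g a.m).toAlternatingMap.map_linearDependent _ hv
    rw [this, abs_zero]
    positivity

/-- Coordinates in a finite basis are bounded by the mass. Consequently every linear endomorphism of
the exterior algebra is bounded, and no separate estimate is needed for extrusion, retraction or
`⊥`. -/
theorem exists_seminorm_le_mass [FiniteDimensional ℝ V] (q : Seminorm ℝ (ExteriorAlgebra ℝ V)) :
    ∃ C : ℝ, 0 ≤ C ∧ ∀ α, q α ≤ C * mass V α := by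
  let e := Module.finBasis ℝ (ExteriorAlgebra ℝ V)
  choose c hc0 hc using fun i => exists_abs_le_mass (e.coord i)
  refine ⟨∑ i, c i * q (e i), Finset.sum_nonneg fun i _ => mul_nonneg (hc0 i) (apply_nonneg q _),
    fun α => ?_⟩
  conv_lhs => rw [← e.sum_repr α]
  refine (Finset.le_sum_of_subadditive q (map_zero q).le (map_add_le_add q) _ _).trans ?_
  rw [Finset.sum_mul]
  refine Finset.sum_le_sum fun i _ => ?_
  rw [map_smul_eq_mul, Real.norm_eq_abs, mul_right_comm]
  exact mul_le_mul_of_nonneg_right (hc i α) (apply_nonneg q _)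

theorem exists_mass_map_le [FiniteDimensional ℝ V]
    (f : ExteriorAlgebra ℝ V →ₗ[ℝ] ExteriorAlgebra ℝ V) :
    ∃ C : ℝ, 0 ≤ C ∧ ∀ α, mass V (f α) ≤ C * mass V α :=
  exists_seminorm_le_mass ((mass V).comp f)

/-- Converts bounds in terms of mass into operator-norm bounds for the values of a form. The sharp
constant plays no role. -/
theorem exists_mass_ιMulti_le [FiniteDimensional ℝ V] (m : ℕ) :
    ∃ C : ℝ, 0 ≤ C ∧ ∀ v : Fin m → V,
      mass V (ExteriorAlgebra.ιMulti ℝ m v) ≤ C * ∏ i, ‖v i‖ := by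
  let e := Module.finBasis ℝ (ExteriorAlgebra ℝ V)
  let g := fun i => contAlternating ((e.coord i).compAlternatingMap (ExteriorAlgebra.ιMulti ℝ m))
  refine ⟨∑ i, ‖g i‖ * mass V (e i),
    Finset.sum_nonneg fun i _ => mul_nonneg (norm_nonneg _) (apply_nonneg _ _), fun v => ?_⟩
  conv_lhs => rw [← e.sum_repr (ExteriorAlgebra.ιMulti ℝ m v)]
  refine (Finset.le_sum_of_subadditive _ (map_zero (mass V)).le
    (map_add_le_add (mass V)) _ _).trans ?_
  rw [Finset.sum_mul]
  refine Finset.sum_le_sum fun i _ => ?_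
  rw [map_smul_eq_mul, mul_right_comm]
  exact mul_le_mul_of_nonneg_right ((g i).le_opNorm v) (apply_nonneg _ _)

end AtomBounds

/-! ### Operators on chains: pointwise actions, prederivatives, degree. -/

section Chains

variable {V : Type*} [NormedAddCommGroup V] [InnerProductSpace ℝ V]

/-! ### Translations and differences of Dirac chains -/

theorem transl_single (u p : V) (α : ExteriorAlgebra ℝ V) :
    transl u (Finsupp.single p α) = Finsupp.single (p + u) α := by
  simp [transl]

theorem pointwise_single (f : ExteriorAlgebra ℝ V →ₗ[ℝ] ExteriorAlgebra ℝ V) (p : V)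
    (α : ExteriorAlgebra ℝ V) :
    pointwise f (Finsupp.single p α) = Finsupp.single p (f α) := by
  simp [pointwise]

theorem transl_add (u w : V) : transl (u + w) = transl u ∘ₗ transl w := by
  refine Finsupp.lhom_ext fun p α => ?_
  rw [LinearMap.comp_apply, transl_single, transl_single, transl_single, add_comm u w, add_assoc]

theorem transl_comm (u w : V) : transl u ∘ₗ transl w = transl w ∘ₗ transl u := by
  rw [← transl_add, ← transl_add, add_comm]

theorem diff_comm (u w : V) (A : Dirac V) : diff u (diff w A) = diff w (diff u A) := by
  have := LinearMap.congr_fun (transl_comm u w) A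
  simp only [LinearMap.comp_apply] at this
  simp only [diff, LinearMap.sub_apply, LinearMap.id_apply, map_sub, this]
  abel

/-- Expand `T_u T_w - I` with `T = I + Δ`. The cross term is what makes `u ↦ Δ_u A` almost additive.
-/
theorem diff_add (u w : V) (A : Dirac V) :
    diff (u + w) A = diff u A + diff w A + diff u (diff w A) := by
  simp only [diff, LinearMap.sub_apply, LinearMap.id_apply, map_sub, transl_add,
    LinearMap.comp_apply]
  abel

theorem pointwise_diff (f : ExteriorAlgebra ℝ V →ₗ[ℝ] ExteriorAlgebra ℝ V) (u : V)
    (A : Dirac V) : pointwise f (diff u A) = diff u (pointwise f A) := by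
  have : pointwise f ∘ₗ transl u = transl u ∘ₗ pointwise f := by
    refine Finsupp.lhom_ext fun p α => ?_
    simp only [LinearMap.comp_apply, transl_single, pointwise_single]
  have := LinearMap.congr_fun this A
  simp only [LinearMap.comp_apply] at this
  simp only [diff, LinearMap.sub_apply, LinearMap.id_apply, map_sub, this]

theorem pointwise_diffs (f : ExteriorAlgebra ℝ V →ₗ[ℝ] ExteriorAlgebra ℝ V) (σ : List V)
    (A : Dirac V) : pointwise f (diffs σ A) = diffs σ (pointwise f A) := by
  induction σ with
  | nil => rfl
  | cons u σ ih => simp only [diffs, LinearMap.comp_apply, pointwise_diff, ih]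

/-- Prepending `v` to `σ` multiplies the cost by `‖v‖` and lengthens `σ` by one, hence the shift of
class. -/
theorem bNorm_diff_le (r : ℕ) (v : V) (A : Dirac V) :
    bNorm V (r + 1) (diff v A) ≤ ‖v‖ * bNorm V r A := by
  refine le_mul_bNorm r ((bNorm V (r + 1)).comp (diff v)) (norm_nonneg v) (fun d hd => ?_) A
  refine (bNorm_chain_le (⟨v :: d.σ, d.p, d.α⟩ : DiffElt V) (by simpa using hd)).trans ?_
  simp [DiffElt.cost, mul_assoc]

theorem bNorm_pointwise_le {f : ExteriorAlgebra ℝ V →ₗ[ℝ] ExteriorAlgebra ℝ V} {C : ℝ}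
    (hC : 0 ≤ C) (hf : ∀ α, mass V (f α) ≤ C * mass V α) (r : ℕ) (A : Dirac V) :
    bNorm V r (pointwise f A) ≤ C * bNorm V r A := by
  refine le_mul_bNorm r ((bNorm V r).comp (pointwise f)) hC (fun d hd => ?_) A
  have h : pointwise f d.chain = (⟨d.σ, d.p, f d.α⟩ : DiffElt V).chain := by
    simp only [DiffElt.chain, pointwise_diffs, pointwise_single]
  change bNorm V r (pointwise f d.chain) ≤ _
  rw [h]
  refine (bNorm_chain_le (⟨d.σ, d.p, f d.α⟩ : DiffElt V) hd).trans ?_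
  simp only [DiffElt.cost]
  rw [mul_left_comm]
  refine mul_le_mul_of_nonneg_left (hf _) (List.prod_nonneg fun a ha => ?_)
  obtain ⟨u, -, rfl⟩ := List.mem_map.1 ha
  exact norm_nonneg u

/-! ### Extension from Dirac chains by continuity -/

theorem norm_ofDirac (r : ℕ) (A : Dirac V) : ‖ofDirac r A‖ = bNorm V r A :=
  UniformSpace.Completion.norm_coe (E := DiracB V r) _

variable (V) in
/-- The inclusion of the Dirac chains, as a linear map. -/
def ofDiracL (r : ℕ) : Dirac V →ₗ[ℝ] Chain V r where
  toFun := ofDirac r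
  map_add' A B := UniformSpace.Completion.coe_add (α := DiracB V r) A B
  map_smul' a A := UniformSpace.Completion.coe_smul (X := DiracB V r) a A

theorem ofDiracL_apply (r : ℕ) (A : Dirac V) : ofDiracL V r A = ofDirac r A := rfl

variable (V) in
/-- The Dirac chains underlying the `B^r`-normed space of Dirac chains. -/
def toDiracL (r : ℕ) : DiracB V r →ₗ[ℝ] Dirac V where
  toFun A := A
  map_add' _ _ := rfl
  map_smul' _ _ := rfl

theorem denseRange_ofDirac (r : ℕ) : DenseRange (ofDirac r : Dirac V → Chain V r) :=
  UniformSpace.Completion.denseRange_coe (α := DiracB V r)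

theorem chain_ext {r : ℕ} {F : Type*} [TopologicalSpace F] [T2Space F] {f g : Chain V r → F}
    (hf : Continuous f) (hg : Continuous g) (h : ∀ A, f (ofDirac r A) = g (ofDirac r A)) :
    f = g :=
  (denseRange_ofDirac r).equalizer hf hg (funext h)

section Ext

variable {r : ℕ} {F : Type*} [NormedAddCommGroup F] [NormedSpace ℝ F] [CompleteSpace F]

/-- The continuous extension of a `B^r`-bounded linear map on Dirac chains. -/
def extL (T : Dirac V →ₗ[ℝ] F) (hT : ∃ C, ∀ A, ‖T A‖ ≤ C * bNorm V r A) : Chain V r →L[ℝ] F :=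
  ContinuousLinearMap.fromCompletion (LinearMap.mkContinuous
    (T ∘ₗ toDiracL V r) hT.choose hT.choose_spec)

/-- The extension is definitionally the one used for `integral` and `prederiv`, so that
`integral_eq` and `bdry_eq` hold by `rfl`. -/
theorem coe_extL (T : Dirac V →ₗ[ℝ] F) (hT : ∃ C, ∀ A, ‖T A‖ ≤ C * bNorm V r A) :
    ⇑(extL T hT) = UniformSpace.Completion.extension
      fun A : DiracB V r => T (show Dirac V from A) := rfl

theorem extL_ofDirac (T : Dirac V →ₗ[ℝ] F) (hT : ∃ C, ∀ A, ‖T A‖ ≤ C * bNorm V r A)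
    (A : Dirac V) : extL T hT (ofDirac r A) = T A := by
  rw [coe_extL]
  exact UniformSpace.Completion.extension_coe
    (LinearMap.mkContinuous
    (T ∘ₗ toDiracL V r) hT.choose
      hT.choose_spec).uniformContinuous _

end Ext

theorem link_ofDirac (r s : ℕ) (h : r ≤ s) (A : Dirac V) :
    link V r s h (ofDirac r A) = ofDirac s A :=
  ContinuousLinearMap.completion_apply_coe (diracLink V r s h) _

theorem continuous_link (r s : ℕ) (h : r ≤ s) : Continuous (link V r s h) :=
  ((diracLink V r s h).completion : Chain V r →L[ℝ] Chain V s).continuous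

/-! ### Pointwise operators -/

section Pointwise

variable [FiniteDimensional ℝ V]

/-- The pointwise action of a linear map on chains of class `B^r`. -/
def pointwiseL (f : ExteriorAlgebra ℝ V →ₗ[ℝ] ExteriorAlgebra ℝ V) (r : ℕ) :
    Chain V r →L[ℝ] Chain V r :=
  extL (ofDiracL V r ∘ₗ pointwise f) (by
    obtain ⟨C, hC, h⟩ := exists_mass_map_le f
    refine ⟨C, fun A => ?_⟩
    rw [LinearMap.comp_apply, ofDiracL_apply, norm_ofDirac]
    exact bNorm_pointwise_le hC h r A)

theorem pointwiseL_ofDirac (f : ExteriorAlgebra ℝ V →ₗ[ℝ] ExteriorAlgebra ℝ V) (r : ℕ)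
    (A : Dirac V) : pointwiseL f r (ofDirac r A) = ofDirac r (pointwise f A) :=
  extL_ofDirac _ _ A

theorem pointwiseL_comp (f g : ExteriorAlgebra ℝ V →ₗ[ℝ] ExteriorAlgebra ℝ V) (r : ℕ)
    (J : Chain V r) : pointwiseL (f ∘ₗ g) r J = pointwiseL f r (pointwiseL g r J) := by
  refine congrFun (chain_ext (pointwiseL (f ∘ₗ g) r).continuous
    ((pointwiseL f r).comp (pointwiseL g r)).continuous fun A => ?_) J
  simp only [ContinuousLinearMap.comp_apply, pointwiseL_ofDirac]
  congr 1
  ext p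
  simp [pointwise]

theorem pointwiseL_add (f g : ExteriorAlgebra ℝ V →ₗ[ℝ] ExteriorAlgebra ℝ V) (r : ℕ)
    (J : Chain V r) : pointwiseL (f + g) r J = pointwiseL f r J + pointwiseL g r J := by
  refine congrFun (chain_ext (pointwiseL (f + g) r).continuous
    (pointwiseL f r + pointwiseL g r).continuous fun A => ?_) J
  simp only [_root_.add_apply, pointwiseL_ofDirac]
  rw [← ofDiracL_apply, ← ofDiracL_apply, ← ofDiracL_apply, ← map_add]
  congr 1
  ext p
  simp [pointwise]

theorem pointwiseL_smul (a : ℝ) (f : ExteriorAlgebra ℝ V →ₗ[ℝ] ExteriorAlgebra ℝ V) (r : ℕ)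
    (J : Chain V r) : pointwiseL (a • f) r J = a • pointwiseL f r J := by
  refine congrFun (chain_ext (pointwiseL (a • f) r).continuous
    (a • pointwiseL f r).continuous fun A => ?_) J
  simp only [_root_.smul_apply, pointwiseL_ofDirac]
  rw [← ofDiracL_apply, ← ofDiracL_apply, ← map_smul]
  congr 1
  ext p
  simp [pointwise]

theorem pointwiseL_id (r : ℕ) (J : Chain V r) : pointwiseL LinearMap.id r J = J := by
  refine congrFun (chain_ext (pointwiseL LinearMap.id r).continuous continuous_id fun A => ?_) J
  rw [pointwiseL_ofDirac, id]
  congr 1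
  ext p
  simp [pointwise]

end Pointwise

/-! ### The prederivative -/

/-- The quadratic error costs two classes. The linear bound costs only one, and it is this bound
that lets the prederivative extend from class `B^(r+1)` to class `B^(r+2)`. -/
theorem exists_prederiv (r : ℕ) (A : Dirac V) :
    ∃ L : V →L[ℝ] Chain V (r + 2),
      (∀ u, ‖ofDirac (r + 2) (diff u A) - L u‖ ≤ bNorm V r A * ‖u‖ ^ 2) ∧
      ∀ u, ‖L u‖ ≤ bNorm V (r + 1) A * ‖u‖ := by
  refine exists_clm_of_almost_additive (G := fun u => ofDirac (r + 2) (diff u A))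
    (fun u w => ?_) fun u => ?_
  · have : ofDirac (r + 2) (diff (u + w) A) - ofDirac (r + 2) (diff u A) -
        ofDirac (r + 2) (diff w A) = ofDirac (r + 2) (diff u (diff w A)) := by
      simp only [← ofDiracL_apply, ← map_sub]
      rw [diff_add]
      congr 1
      abel
    rw [this, norm_ofDirac]
    refine (bNorm_diff_le _ _ _).trans ?_
    refine (mul_le_mul_of_nonneg_left (bNorm_diff_le _ _ _) (norm_nonneg u)).trans (le_of_eq ?_)
    ring
  · rw [norm_ofDirac, mul_comm]
    exact bNorm_diff_le _ _ _

theorem tendsto_of_quadratic {F : Type*} [NormedAddCommGroup F] [NormedSpace ℝ F] {G : V → F}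
    {L : V →L[ℝ] F} {K : ℝ} (h : ∀ u, ‖G u - L u‖ ≤ K * ‖u‖ ^ 2) (v : V) :
    Tendsto (fun t : ℝ => t⁻¹ • G (t • v)) (𝓝[≠] 0) (𝓝 (L v)) := by
  rw [tendsto_iff_norm_sub_tendsto_zero]
  have h1 : Tendsto (fun t : ℝ => |t| * (K * ‖v‖ ^ 2)) (𝓝[≠] 0) (𝓝 0) := by
    have : Tendsto (fun t : ℝ => |t| * (K * ‖v‖ ^ 2)) (𝓝 0) (𝓝 (|0| * (K * ‖v‖ ^ 2))) :=
      (Continuous.tendsto (by fun_prop) 0)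
    rw [abs_zero, zero_mul] at this
    exact this.mono_left nhdsWithin_le_nhds
  refine squeeze_zero' (Eventually.of_forall fun _ => norm_nonneg _) ?_ h1
  filter_upwards [self_mem_nhdsWithin] with t ht
  have ht : t ≠ 0 := ht
  have h2 : t⁻¹ • G (t • v) - L v = t⁻¹ • (G (t • v) - L (t • v)) := by
    rw [map_smul, smul_sub, inv_smul_smul₀ ht]
  rw [h2, norm_smul]
  refine (mul_le_mul_of_nonneg_left (h _) (norm_nonneg _)).trans (le_of_eq ?_)
  rw [norm_smul, norm_inv, Real.norm_eq_abs]
  have : |t| ≠ 0 := abs_ne_zero.2 ht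
  field_simp

theorem tendsto_ofDirac_diff {r : ℕ} {A : Dirac V} {L : V →L[ℝ] Chain V r} {K : ℝ}
    (h : ∀ u, ‖ofDirac r (diff u A) - L u‖ ≤ K * ‖u‖ ^ 2) (v : V) :
    Tendsto (fun t : ℝ => ofDirac r (t⁻¹ • diff (t • v) A)) (𝓝[≠] 0) (𝓝 (L v)) := by
  refine (tendsto_of_quadratic h v).congr fun t => ?_
  rw [← ofDiracL_apply, ← ofDiracL_apply, map_smul]

theorem tendsto_preDirac (v : V) {r : ℕ} (hr : 1 ≤ r) (A : Dirac V) :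
    Tendsto (fun t : ℝ => ofDirac (r + 1) (t⁻¹ • diff (t • v) A)) (𝓝[≠] 0)
      (𝓝 (preDirac v r A)) := by
  obtain ⟨r, rfl⟩ := Nat.exists_eq_add_of_le' hr
  obtain ⟨L, hL, -⟩ := exists_prederiv r A
  exact tendsto_nhds_limUnder ⟨L v, tendsto_ofDirac_diff hL v⟩

theorem preDirac_spec (r : ℕ) (A : Dirac V) :
    ∃ L : V →L[ℝ] Chain V (r + 2), (∀ v, preDirac v (r + 1) A = L v) ∧
      (∀ u, ‖ofDirac (r + 2) (diff u A) - L u‖ ≤ bNorm V r A * ‖u‖ ^ 2) ∧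
      ∀ u, ‖L u‖ ≤ bNorm V (r + 1) A * ‖u‖ := by
  obtain ⟨L, hL, h⟩ := exists_prederiv r A
  exact ⟨L, fun v => tendsto_nhds_unique (tendsto_preDirac v (by omega) A)
    (tendsto_ofDirac_diff hL v), hL, h⟩

theorem norm_preDirac_le (v : V) {r : ℕ} (hr : 1 ≤ r) (A : Dirac V) :
    ‖preDirac v r A‖ ≤ ‖v‖ * bNorm V r A := by
  obtain ⟨r, rfl⟩ := Nat.exists_eq_add_of_le' hr
  obtain ⟨L, h, -, hM⟩ := preDirac_spec r A
  rw [h, mul_comm]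
  exact hM v

theorem norm_sub_preDirac_le (v : V) (r : ℕ) (A : Dirac V) :
    ‖ofDirac (r + 2) (diff v A) - preDirac v (r + 1) A‖ ≤ bNorm V r A * ‖v‖ ^ 2 := by
  obtain ⟨L, h, hL, -⟩ := preDirac_spec r A
  rw [h]
  exact hL v

theorem preDirac_smul_dir (t : ℝ) (v : V) {r : ℕ} (hr : 1 ≤ r) (A : Dirac V) :
    preDirac (t • v) r A = t • preDirac v r A := by
  obtain ⟨r, rfl⟩ := Nat.exists_eq_add_of_le' hr
  obtain ⟨L, h, -⟩ := preDirac_spec r A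
  simp [h]

/-- The prederivative of Dirac chains, as a linear map. -/
def preDiracL (v : V) {r : ℕ} (hr : 1 ≤ r) : Dirac V →ₗ[ℝ] Chain V (r + 1) where
  toFun := preDirac v r
  map_add' A B := by
    refine tendsto_nhds_unique (tendsto_preDirac v hr _) ?_
    refine ((tendsto_preDirac v hr A).add (tendsto_preDirac v hr B)).congr fun t => ?_
    rw [map_add, smul_add, ← ofDiracL_apply, ← ofDiracL_apply, ← ofDiracL_apply, map_add]
  map_smul' a A := by
    refine tendsto_nhds_unique (tendsto_preDirac v hr _) ?_
    refine ((tendsto_preDirac v hr A).const_smul a).congr fun t => ?_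
    rw [map_smul, smul_comm, ← ofDiracL_apply, ← ofDiracL_apply, ← map_smul, ← map_smul]

/-- The prederivative, as a continuous linear map. -/
def prederivL (v : V) {r : ℕ} (hr : 1 ≤ r) : Chain V r →L[ℝ] Chain V (r + 1) :=
  extL (preDiracL v hr) ⟨‖v‖, norm_preDirac_le v hr⟩

theorem prederivL_ofDirac (v : V) {r : ℕ} (hr : 1 ≤ r) (A : Dirac V) :
    prederivL v hr (ofDirac r A) = preDirac v r A :=
  extL_ofDirac _ _ A

theorem link_prederivL (v : V) {r s : ℕ} (hr : 1 ≤ r) (h : r ≤ s) (J : Chain V r) :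
    link V (r + 1) (s + 1) (by omega) (prederivL v hr J) =
      prederivL v (hr.trans h) (link V r s h J) := by
  refine congrFun (chain_ext (f := fun J => link V (r + 1) (s + 1) _ (prederivL v hr J))
    (g := fun J => prederivL v (hr.trans h) (link V r s h J))
    ((continuous_link _ _ _).comp (prederivL v hr).continuous)
    ((prederivL v (hr.trans h)).continuous.comp (continuous_link r s h)) fun A => ?_) J
  simp only [prederivL_ofDirac, link_ofDirac]
  refine tendsto_nhds_unique ?_ (tendsto_preDirac v (hr.trans h) A)
  refine (((continuous_link (r + 1) (s + 1) (by omega)).tendsto _).comp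
    (tendsto_preDirac v hr A)).congr fun t => ?_
  simp only [Function.comp_apply, link_ofDirac]

theorem pointwiseL_prederivL [FiniteDimensional ℝ V]
    (f : ExteriorAlgebra ℝ V →ₗ[ℝ] ExteriorAlgebra ℝ V) (v : V) {r : ℕ}
    (hr : 1 ≤ r) (J : Chain V r) :
    pointwiseL f (r + 1) (prederivL v hr J) = prederivL v hr (pointwiseL f r J) := by
  refine congrFun (chain_ext ((pointwiseL f (r + 1)).comp (prederivL v hr)).continuous
    ((prederivL v hr).comp (pointwiseL f r)).continuous fun A => ?_) J
  simp only [ContinuousLinearMap.comp_apply, prederivL_ofDirac, pointwiseL_ofDirac]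
  refine tendsto_nhds_unique ?_ (tendsto_preDirac v hr _)
  refine (((pointwiseL f (r + 1)).continuous.tendsto _).comp
    (tendsto_preDirac v hr A)).congr fun t => ?_
  simp only [Function.comp_apply, pointwiseL_ofDirac, map_smul, pointwise_diff]

/-- Replaces an iterated limit by a single limit of second difference quotients. These are symmetric
in `v` and `w`, so `prederivL_comm` follows by uniqueness of limits. -/
theorem tendsto_prederivL_preDirac (v w : V) {r : ℕ} (hr : 1 ≤ r) (A : Dirac V) :
    Tendsto (fun t : ℝ => ofDirac (r + 2) (t⁻¹ • t⁻¹ • diff (t • v) (diff (t • w) A)))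
      (𝓝[≠] 0) (𝓝 (prederivL v (Nat.le_succ_of_le hr) (preDirac w r A))) := by
  have hr' : 1 ≤ r + 1 := Nat.le_succ_of_le hr
  have h1 := ((prederivL v hr').continuous.tendsto _).comp (tendsto_preDirac w hr A)
  have h2 : Tendsto (fun t : ℝ => |t| * (‖w‖ * bNorm V (r - 1) A * ‖v‖ ^ 2)) (𝓝[≠] 0) (𝓝 0) := by
    have : Tendsto (fun t : ℝ => |t| * (‖w‖ * bNorm V (r - 1) A * ‖v‖ ^ 2)) (𝓝 0)
        (𝓝 (|0| * (‖w‖ * bNorm V (r - 1) A * ‖v‖ ^ 2))) :=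
      Continuous.tendsto (by fun_prop) 0
    rw [abs_zero, zero_mul] at this
    exact this.mono_left nhdsWithin_le_nhds
  rw [tendsto_iff_norm_sub_tendsto_zero] at h1 ⊢
  have h3 := h2.add h1
  rw [add_zero] at h3
  refine squeeze_zero' (Eventually.of_forall fun _ => norm_nonneg _) ?_ h3
  filter_upwards [self_mem_nhdsWithin] with t ht
  have ht : t ≠ 0 := ht
  -- The intermediate term applies `P_v` to the first difference quotient. Its distance to the
  -- double quotient is bounded by the quadratic estimate for the chain `Δ_{tw} A`, which is itself
  -- `O(t)` in `B^r`. The product `t⁻² · |t| · t²` leaves `|t|`.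
  refine (norm_sub_le_norm_sub_add_norm_sub _
    (prederivL v hr' (ofDirac (r + 1) (t⁻¹ • diff (t • w) A))) _).trans ?_
  refine add_le_add ?_ le_rfl
  have h4 : ofDirac (r + 2) (t⁻¹ • t⁻¹ • diff (t • v) (diff (t • w) A)) -
      prederivL v hr' (ofDirac (r + 1) (t⁻¹ • diff (t • w) A)) =
      (t⁻¹ * t⁻¹) • (ofDirac (r + 2) (diff (t • v) (diff (t • w) A)) -
        preDirac (t • v) (r + 1) (diff (t • w) A)) := by
    rw [preDirac_smul_dir t v hr', ← prederivL_ofDirac v hr', smul_sub,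
      smul_smul (t⁻¹ * t⁻¹) t, inv_mul_cancel_right₀ ht]
    simp only [← ofDiracL_apply, map_smul, smul_smul]
  rw [h4, norm_smul]
  refine (mul_le_mul_of_nonneg_left (norm_sub_preDirac_le _ _ _) (norm_nonneg _)).trans ?_
  have h5 : bNorm V r (diff (t • w) A) ≤ |t| * ‖w‖ * bNorm V (r - 1) A := by
    have := bNorm_diff_le (r - 1) (t • w) A
    rwa [Nat.sub_add_cancel hr, norm_smul, Real.norm_eq_abs] at this
  rw [norm_smul, norm_mul, norm_inv, Real.norm_eq_abs]
  have h6 : |t| ≠ 0 := abs_ne_zero.2 ht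
  calc |t|⁻¹ * |t|⁻¹ * (bNorm V r (diff (t • w) A) * (|t| * ‖v‖) ^ 2)
      ≤ |t|⁻¹ * |t|⁻¹ * (|t| * ‖w‖ * bNorm V (r - 1) A * (|t| * ‖v‖) ^ 2) := by gcongr
    _ = |t| * (‖w‖ * bNorm V (r - 1) A * ‖v‖ ^ 2) := by field_simp

theorem prederivL_comm (v w : V) {r : ℕ} (hr : 1 ≤ r) (J : Chain V r) :
    prederivL v (Nat.le_succ_of_le hr) (prederivL w hr J) =
      prederivL w (Nat.le_succ_of_le hr) (prederivL v hr J) := by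
  refine congrFun (chain_ext ((prederivL v (Nat.le_succ_of_le hr)).comp (prederivL w hr)).continuous
    ((prederivL w (Nat.le_succ_of_le hr)).comp (prederivL v hr)).continuous fun A => ?_) J
  simp only [ContinuousLinearMap.comp_apply, prederivL_ofDirac]
  refine tendsto_nhds_unique (tendsto_prederivL_preDirac v w hr A) ?_
  refine (tendsto_prederivL_preDirac w v hr A).congr fun t => ?_
  rw [diff_comm]

/-! ### Degree -/

variable (V) in
/-- The Dirac `k`-chains as a subspace. -/
def diracSub (k : ℕ) : Submodule ℝ (Dirac V) where
  carrier := diracDeg V k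
  add_mem' hA hB p := Submodule.add_mem _ (hA p) (hB p)
  zero_mem' _ := Submodule.zero_mem _
  smul_mem' a _ hA p := Submodule.smul_mem _ a (hA p)

variable (V) in
/-- The `k`-chains of class `B^r` as a subspace. -/
def chainSub (k r : ℕ) : Submodule ℝ (Chain V r) :=
  ((diracSub V k).map (ofDiracL V r)).topologicalClosure

theorem diff_mem_diracSub (k : ℕ) (u : V) {A : Dirac V} (hA : A ∈ diracSub V k) :
    diff u A ∈ diracSub V k := by
  refine Submodule.sub_mem _ (fun p => ?_) hA
  have h : transl u A p = A (p - u) := by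
    have := Finsupp.mapDomain_apply (add_left_injective u) A (p - u)
    rwa [sub_add_cancel] at this
  rw [h]
  exact hA _

theorem ofDirac_mem_chainSub {k : ℕ} (r : ℕ) {A : Dirac V} (hA : A ∈ diracSub V k) :
    ofDirac r A ∈ chainSub V k r :=
  subset_closure ⟨A, hA, rfl⟩

/-- The `k`-chains are the closure of the Dirac `k`-chains, so a continuous map need only be tested
on the latter. -/
theorem map_mem_chainSub {k r s : ℕ} {T : Chain V r → Chain V s} (hT : Continuous T)
    (h : ∀ A ∈ diracSub V k, T (ofDirac r A) ∈ chainSub V k s) {J : Chain V r}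
    (hJ : J ∈ chainSub V k r) : T J ∈ chainSub V k s := by
  have h1 : closure (ofDirac r '' diracDeg V k) ⊆ T ⁻¹' (chainSub V k s : Set (Chain V s)) := by
    refine closure_minimal ?_ ((Submodule.isClosed_topologicalClosure _).preimage hT)
    rintro _ ⟨A, hA, rfl⟩
    exact h A hA
  exact h1 hJ

theorem preDirac_mem_chainSub {k : ℕ} (v : V) {r : ℕ} (hr : 1 ≤ r) {A : Dirac V}
    (hA : A ∈ diracSub V k) : preDirac v r A ∈ chainSub V k (r + 1) := by
  refine (Submodule.isClosed_topologicalClosure _).mem_of_tendsto (tendsto_preDirac v hr A)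
    (Eventually.of_forall fun t => ?_)
  exact ofDirac_mem_chainSub _ (Submodule.smul_mem _ _ (diff_mem_diracSub _ _ hA))

theorem prederivL_mem_chainSub {k : ℕ} (v : V) {r : ℕ} (hr : 1 ≤ r) {J : Chain V r}
    (hJ : J ∈ chainSub V k r) : prederivL v hr J ∈ chainSub V k (r + 1) := by
  refine map_mem_chainSub (prederivL v hr).continuous (fun A hA => ?_) hJ
  rw [prederivL_ofDirac]
  exact preDirac_mem_chainSub v hr hA

theorem link_mem_chainSub {k r s : ℕ} (h : r ≤ s) {J : Chain V r} (hJ : J ∈ chainSub V k r) :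
    link V r s h J ∈ chainSub V k s := by
  refine map_mem_chainSub (continuous_link r s h) (fun A hA => ?_) hJ
  rw [link_ofDirac]
  exact ofDirac_mem_chainSub _ hA

end Chains

/-! ### Forms as functionals on chains: derivatives, Stokes' theorem, star, and the dual Laplacians.
-/

section Forms

variable {V : Type*} [NormedAddCommGroup V] [InnerProductSpace ℝ V] {n : ℕ}

/-! ### Forms of class `B^r` -/

/-- A form of mixed degree is of class `B^r` if its evaluation is bounded in the `B^r` norm. -/
def Form.IsB (r : ℕ) (ω : Form V) : Prop := ∃ C, ∀ A, ‖ω.eval A‖ ≤ C * bNorm V r A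

theorem Form.IsB.mono {r s : ℕ} (h : r ≤ s) {ω : Form V} (hω : ω.IsB s) : ω.IsB r := by
  obtain ⟨C, hC⟩ := hω
  refine ⟨|C|, fun A => (hC A).trans ?_⟩
  exact mul_le_mul (le_abs_self C) (bNorm_anti h A) (apply_nonneg _ _) (abs_nonneg _)

/-- Difference chains are the atoms of the `B^r` norm, so a bound for each length `j ≤ r` is a bound
on the whole norm; the finitely many constants are summed. -/
theorem Form.isB_iff {r : ℕ} {ω : Form V} :
    ω.IsB r ↔ ∀ j ≤ r, ∃ C : ℝ, ∀ d : DiffElt V, d.σ.length = j →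
      |ω.eval d.chain| ≤ C * d.cost := by
  constructor
  · intro h j hj
    obtain ⟨C, hC⟩ := h.mono hj
    refine ⟨|C|, fun d hd => (hC _).trans ?_⟩
    exact mul_le_mul (le_abs_self C) (bNorm_chain_le d hd.le) (apply_nonneg _ _) (abs_nonneg _)
  · intro h
    choose! C hC using h
    have h0 : 0 ≤ ∑ j ∈ Finset.range (r + 1), |C j| := Finset.sum_nonneg fun _ _ => abs_nonneg _
    refine ⟨_, le_mul_bNorm r ((normSeminorm ℝ ℝ).comp ω.eval) h0 fun d hd => ?_⟩
    refine (hC _ hd d rfl).trans (mul_le_mul_of_nonneg_right ?_ d.cost_nonneg)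
    exact (le_abs_self _).trans (Finset.single_le_sum (f := fun j => |C j|)
      (fun _ _ => abs_nonneg _) (Finset.mem_range.2 (Nat.lt_succ_of_le hd)))

theorem mem_formDeg_natCast {k r : ℕ} {ω : Form V} :
    ω ∈ formDeg V k (r : ℕ∞) ↔ (∀ j, j ≠ k → ω j = 0) ∧ ω.IsB r := by
  simp only [formDeg, Set.mem_ofPred_eq, Nat.cast_le, Form.isB_iff]

theorem mem_formDeg_top {k : ℕ} {ω : Form V} :
    ω ∈ formDeg V k ⊤ ↔ (∀ j, j ≠ k → ω j = 0) ∧ ∀ r, ω.IsB r := by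
  simp only [formDeg, Set.mem_ofPred_eq, le_top, forall_const, Form.isB_iff]
  exact and_congr_right fun _ => ⟨fun h r j _ => h j, fun h j => h j j le_rfl⟩

/-! ### Evaluation on Dirac chains -/

theorem Form.eval_single (ω : Form V) (p : V) (α : ExteriorAlgebra ℝ V) :
    ω.eval (Finsupp.single p α) = ω.val p α := by
  simp [Form.eval]

theorem Form.val_ιMulti (ω : Form V) (p : V) {m : ℕ} (v : Fin m → V) :
    ω.val p (ExteriorAlgebra.ιMulti ℝ m v) = ω m p v := by
  simp [Form.val, ExteriorAlgebra.liftAlternating_apply_ιMulti]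

theorem Form.eval_single_ιMulti (ω : Form V) (p : V) {m : ℕ} (v : Fin m → V) :
    ω.eval (Finsupp.single p (ExteriorAlgebra.ιMulti ℝ m v)) = ω m p v := by
  rw [eval_single, val_ιMulti]

theorem dirac_lhom_ext {F : Type*} [AddCommGroup F] [Module ℝ F] {T S : Dirac V →ₗ[ℝ] F}
    (h : ∀ (p : V) (m : ℕ) (v : Fin m → V),
      T (Finsupp.single p (ExteriorAlgebra.ιMulti ℝ m v)) =
        S (Finsupp.single p (ExteriorAlgebra.ιMulti ℝ m v))) : T = S := by
  refine Finsupp.lhom_ext' fun p => ExteriorAlgebra.lhom_ext ?_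
  intro m
  ext v
  exact h p m v

/-- Allows identities between forms to be derived from identities between chains. -/
theorem Form.eval_injective {ω η : Form V} (h : ω.eval = η.eval) : ω = η := by
  funext m p
  ext v
  rw [← ω.eval_single_ιMulti, ← η.eval_single_ιMulti, h]

theorem Form.eval_add (ω η : Form V) : (ω + η).eval = ω.eval + η.eval :=
  dirac_lhom_ext fun p m v => by
    rw [LinearMap.add_apply]
    simp only [eval_single_ιMulti]
    rfl

theorem Form.eval_smul (a : ℝ) (ω : Form V) : (a • ω).eval = a • ω.eval :=
  dirac_lhom_ext fun p m v => by
    rw [LinearMap.smul_apply]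
    simp only [eval_single_ιMulti]
    rfl

theorem Form.eval_sum {ι : Type*} (s : Finset ι) (ω : ι → Form V) :
    (∑ i ∈ s, ω i).eval = ∑ i ∈ s, (ω i).eval :=
  map_sum (AddMonoidHom.mk' (Form.eval : Form V → _) eval_add) ω s

/-! ### Integration -/

/-- Integration of a form of class `B^r`, as a continuous functional. -/
def integralL {r : ℕ} {ω : Form V} (hω : ω.IsB r) : Chain V r →L[ℝ] ℝ := extL ω.eval hω

theorem integral_eq {r : ℕ} {ω : Form V} (hω : ω.IsB r) (J : Chain V r) :
    integral J ω = integralL hω J := rfl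

theorem integral_ofDirac {r : ℕ} {ω : Form V} (hω : ω.IsB r) (A : Dirac V) :
    integral (ofDirac r A) ω = ω.eval A := by
  rw [integral_eq hω]
  exact extL_ofDirac _ _ A

theorem Form.IsB.add {r : ℕ} {ω η : Form V} (hω : ω.IsB r) (hη : η.IsB r) : (ω + η).IsB r := by
  obtain ⟨C, hC⟩ := hω
  obtain ⟨D, hD⟩ := hη
  refine ⟨C + D, fun A => ?_⟩
  rw [Form.eval_add, LinearMap.add_apply, add_mul]
  exact (norm_add_le _ _).trans (add_le_add (hC A) (hD A))

theorem integral_add_form {r : ℕ} {ω η : Form V} (hω : ω.IsB r) (hη : η.IsB r) (J : Chain V r) :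
    integral J (ω + η) = integral J ω + integral J η := by
  refine congrFun (chain_ext (integralL (hω.add hη)).continuous
    (integralL hω + integralL hη).continuous fun A => ?_) J
  rw [_root_.add_apply, ← integral_eq, ← integral_eq, ← integral_eq, integral_ofDirac (hω.add hη),
    integral_ofDirac hω, integral_ofDirac hη, Form.eval_add, LinearMap.add_apply]

theorem integral_link {r s : ℕ} (h : r ≤ s) {ω : Form V} (hω : ω.IsB s) (J : Chain V r) :
    integral (link V r s h J) ω = integral J ω := by
  refine congrFun (chain_ext (f := fun J => integral (link V r s h J) ω)
    (g := fun J => integral J ω) ((integralL hω).continuous.comp (continuous_link r s h))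
    (integralL (hω.mono h)).continuous fun A => ?_) J
  simp only [link_ofDirac, integral_ofDirac hω, integral_ofDirac (hω.mono h)]

variable [FiniteDimensional ℝ V]

theorem Form.isB_of_eval_comp_pointwise {r : ℕ} {ω η : Form V} (hω : ω.IsB r)
    {f : ExteriorAlgebra ℝ V →ₗ[ℝ] ExteriorAlgebra ℝ V}
    (h : ∀ A, η.eval A = ω.eval (pointwise f A)) : η.IsB r := by
  refine ⟨‖(integralL hω).comp (pointwiseL f r)‖, fun A => ?_⟩
  rw [h, ← integral_ofDirac hω, ← pointwiseL_ofDirac, integral_eq hω, ← norm_ofDirac r A]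
  exact ((integralL hω).comp (pointwiseL f r)).le_opNorm _

theorem integral_pointwiseL {r : ℕ} {ω η : Form V} (hω : ω.IsB r)
    {f : ExteriorAlgebra ℝ V →ₗ[ℝ] ExteriorAlgebra ℝ V}
    (h : ∀ A, η.eval A = ω.eval (pointwise f A)) (J : Chain V r) :
    integral (pointwiseL f r J) ω = integral J η := by
  have hη := Form.isB_of_eval_comp_pointwise hω h
  refine congrFun (chain_ext ((integralL hω).comp (pointwiseL f r)).continuous
    (integralL hη).continuous fun A => ?_) J
  rw [ContinuousLinearMap.comp_apply, pointwiseL_ofDirac, ← integral_eq, ← integral_eq,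
    integral_ofDirac hω, integral_ofDirac hη, h]

/-! ### Derivatives of forms -/

/-- The additivity defect of `u ↦ ω(p + u) - ω(p)` on `v` is `ω(Δ_u Δ_w (p; v₁ ∧ ⋯ ∧ v_m))`, which
the `B^2` bound controls. -/
theorem Form.exists_fderiv {ω : Form V} (hω : ω.IsB 2) (m : ℕ) (p : V) :
    ∃ (L : V →L[ℝ] V [⋀^Fin m]→L[ℝ] ℝ) (K : ℝ),
      ∀ u, ‖ω m (p + u) - ω m p - L u‖ ≤ K * ‖u‖ ^ 2 := by
  obtain ⟨C, hC⟩ := hω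
  obtain ⟨D, hD, hD'⟩ := exists_mass_ιMulti_le (V := V) m
  have hmass : ∀ v : Fin m → V, bNorm V 0 (Finsupp.single p (ExteriorAlgebra.ιMulti ℝ m v)) ≤
      D * ∏ i, ‖v i‖ := fun v => by
    refine (bNorm_chain_le (⟨[], p, _⟩ : DiffElt V) le_rfl).trans ?_
    simpa [DiffElt.cost] using hD' v
  have hev : ∀ u (v : Fin m → V), ω.eval (diff u (Finsupp.single p (ExteriorAlgebra.ιMulti ℝ m v)))
      = ω m (p + u) v - ω m p v := fun u v => by
    rw [diff, LinearMap.sub_apply, transl_single, LinearMap.id_apply, map_sub,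
      eval_single_ιMulti, eval_single_ιMulti]
  have hC0 : ∀ A, ‖ω.eval A‖ ≤ |C| * bNorm V 2 A := fun A =>
    (hC A).trans (mul_le_mul_of_nonneg_right (le_abs_self C) (apply_nonneg _ _))
  suffices h : ∃ L : V →L[ℝ] V [⋀^Fin m]→L[ℝ] ℝ,
      (∀ u, ‖ω m (p + u) - ω m p - L u‖ ≤ |C| * D * ‖u‖ ^ 2) ∧ ∀ u, ‖L u‖ ≤ |C| * D * ‖u‖ from
    h.imp fun L hL => ⟨_, hL.1⟩
  refine exists_clm_of_almost_additive (G := fun u => ω m (p + u) - ω m p)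
    (fun u w => ?_) fun u => ?_
  · refine ContinuousAlternatingMap.opNorm_le_bound _ (by positivity) fun v => ?_
    set A : Dirac V := Finsupp.single p (ExteriorAlgebra.ιMulti ℝ m v) with hA
    have h1 : (ω m (p + (u + w)) - ω m p - (ω m (p + u) - ω m p) - (ω m (p + w) - ω m p)) v =
        ω.eval (diff u (diff w A)) := by
      have h2 := congrArg ω.eval (diff_add u w A)
      rw [map_add, map_add, hev, hev, hev] at h2
      simp only [ContinuousAlternatingMap.sub_apply]
      linarith
    rw [h1]
    calc ‖ω.eval (diff u (diff w A))‖ ≤ |C| * bNorm V 2 (diff u (diff w A)) := hC0 _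
      _ ≤ |C| * (‖u‖ * (‖w‖ * (D * ∏ i, ‖v i‖))) := by
        refine mul_le_mul_of_nonneg_left ((bNorm_diff_le 1 u _).trans ?_) (abs_nonneg C)
        refine mul_le_mul_of_nonneg_left ((bNorm_diff_le 0 w A).trans ?_) (norm_nonneg u)
        exact mul_le_mul_of_nonneg_left (hmass v) (norm_nonneg w)
      _ = |C| * D * (‖u‖ * ‖w‖) * ∏ i, ‖v i‖ := by ring
  · refine ContinuousAlternatingMap.opNorm_le_bound _ (by positivity) fun v => ?_
    rw [ContinuousAlternatingMap.sub_apply, ← hev]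
    set A : Dirac V := Finsupp.single p (ExteriorAlgebra.ιMulti ℝ m v) with hA
    calc ‖ω.eval (diff u A)‖ ≤ |C| * bNorm V 2 (diff u A) := hC0 _
      _ ≤ |C| * (‖u‖ * (D * ∏ i, ‖v i‖)) := by
        refine mul_le_mul_of_nonneg_left ((bNorm_diff_le 1 u _).trans ?_) (abs_nonneg C)
        exact mul_le_mul_of_nonneg_left ((bNorm_anti zero_le_one A).trans (hmass v))
          (norm_nonneg u)
      _ = |C| * D * ‖u‖ * ∏ i, ‖v i‖ := by ring

theorem Form.exists_hasFDerivAt {ω : Form V} (hω : ω.IsB 2) (m : ℕ) (p : V) :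
    ∃ K : ℝ, HasFDerivAt (ω m) (fderiv ℝ (ω m) p) p ∧
      ∀ u, ‖ω m (p + u) - ω m p - fderiv ℝ (ω m) p u‖ ≤ K * ‖u‖ ^ 2 := by
  obtain ⟨L, K, h⟩ := Form.exists_fderiv hω m p
  have hL : HasFDerivAt (ω m) L p := by
    rw [hasFDerivAt_iff_isLittleO_nhds_zero]
    refine (Asymptotics.IsBigO.of_bound K (Eventually.of_forall fun u => ?_)).trans_isLittleO
      (Asymptotics.isLittleO_norm_pow_id one_lt_two)
    rw [norm_pow, norm_norm]
    exact h u
  rw [hL.fderiv]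
  exact ⟨K, hL, h⟩

theorem Form.differentiable {ω : Form V} (hω : ω.IsB 2) (m : ℕ) : Differentiable ℝ (ω m) :=
  fun p => (Form.exists_hasFDerivAt hω m p).choose_spec.1.differentiableAt

/-- The directional derivative of a form. -/
def Form.deriv (v : V) (ω : Form V) : Form V := fun m p => fderiv ℝ (ω m) p v

/-- Both sides are limits of the same quotients `(ω(p + tv; α) - ω(p; α)) / t`, one taken among
forms and the other among chains. -/
theorem Form.eval_deriv (v : V) {r : ℕ} (hr : 1 ≤ r) {ω : Form V} (hω : ω.IsB (r + 1)) :
    (ω.deriv v).eval = (integralL hω).toLinearMap ∘ₗ preDiracL v hr := by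
  refine dirac_lhom_ext fun p m w => ?_
  obtain ⟨K, -, hK⟩ := Form.exists_hasFDerivAt (hω.mono (by omega : 2 ≤ r + 1)) m p
  rw [eval_single_ιMulti]
  have h1 := tendsto_of_quadratic (G := fun u => ω m (p + u) - ω m p) hK v
  have h2 : Continuous fun f : V [⋀^Fin m]→L[ℝ] ℝ => f w := by fun_prop
  refine tendsto_nhds_unique ((h2.tendsto _).comp h1) ?_
  refine (((integralL hω).continuous.tendsto _).comp (tendsto_preDirac v hr _)).congr fun t => ?_
  simp only [Function.comp_apply]
  rw [← integral_eq, integral_ofDirac hω, map_smul, diff, LinearMap.sub_apply, transl_single,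
    LinearMap.id_apply, map_sub, eval_single_ιMulti, eval_single_ιMulti]
  rfl

theorem Form.IsB.deriv (v : V) {r : ℕ} (hr : 1 ≤ r) {ω : Form V} (hω : ω.IsB (r + 1)) :
    (ω.deriv v).IsB r := by
  refine ⟨‖(integralL hω).comp (prederivL v hr)‖, fun A => ?_⟩
  rw [Form.eval_deriv v hr hω, ← norm_ofDirac r A]
  refine le_trans (le_of_eq ?_) (((integralL hω).comp (prederivL v hr)).le_opNorm _)
  rw [ContinuousLinearMap.comp_apply, prederivL_ofDirac]
  rfl

theorem integral_prederivL (v : V) {r : ℕ} (hr : 1 ≤ r) {ω : Form V} (hω : ω.IsB (r + 1))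
    (J : Chain V r) : integral (prederivL v hr J) ω = integral J (ω.deriv v) := by
  have hd := hω.deriv v hr
  refine congrFun (chain_ext ((integralL hω).comp (prederivL v hr)).continuous
    (integralL hd).continuous fun A => ?_) J
  rw [ContinuousLinearMap.comp_apply, prederivL_ofDirac, ← integral_eq hd, integral_ofDirac hd,
    Form.eval_deriv v hr hω]
  rfl

/-! ### Exterior derivative and boundary -/

-- Contraction is an antiderivation, so induction peels off the first vector. The resulting
-- alternating sum has the shape of the exterior derivative.
omit [FiniteDimensional ℝ V] in
theorem retVec_ιMulti (x : V) {m : ℕ} (v : Fin (m + 1) → V) :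
    retVec x (ExteriorAlgebra.ιMulti ℝ (m + 1) v) = ∑ j : Fin (m + 1),
      ((-1 : ℝ) ^ (j : ℕ) * inner ℝ x (v j)) • ExteriorAlgebra.ιMulti ℝ m (j.removeNth v) := by
  induction m with
  | zero =>
    rw [ExteriorAlgebra.ιMulti_succ_apply]
    simp only [ExteriorAlgebra.ιMulti_zero_apply, mul_one, retVec]
    erw [CliffordAlgebra.contractLeft_ι]
    simp [Algebra.algebraMap_eq_smul_one]
  | succ m ih =>
    rw [ExteriorAlgebra.ιMulti_succ_apply, Fin.sum_univ_succ]
    have h1 : retVec x (ExteriorAlgebra.ι ℝ (v 0) *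
        ExteriorAlgebra.ιMulti ℝ (m + 1) (Matrix.vecTail v)) =
        (inner ℝ x (v 0) : ℝ) • ExteriorAlgebra.ιMulti ℝ (m + 1) (Matrix.vecTail v) -
        ExteriorAlgebra.ι ℝ (v 0) *
          retVec x (ExteriorAlgebra.ιMulti ℝ (m + 1) (Matrix.vecTail v)) :=
      CliffordAlgebra.contractLeft_ι_mul (innerₗ V x) (v 0) _
    rw [h1, ih, sub_eq_add_neg, Finset.mul_sum, ← Finset.sum_neg_distrib]
    congr 1
    · simp only [Fin.val_zero, pow_zero, one_mul]
      rfl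
    · refine Finset.sum_congr rfl fun j _ => ?_
      rw [ExteriorAlgebra.ιMulti_succ_apply, Fin.val_succ, pow_succ, mul_smul_comm, ← neg_smul]
      congr 1
      · simp [Matrix.vecTail]
      · congr 2
        funext i
        simp [Matrix.vecTail, Fin.removeNth, Fin.succ_succAbove_succ]

omit [FiniteDimensional ℝ V] in
theorem Form.eval_d (b : OrthonormalBasis (Fin n) ℝ V) (ω : Form V) (A : Dirac V) :
    ω.d.eval A = ∑ i, (ω.deriv (b i)).eval (pointwise (retVec (b i)) A) := by
  have : ω.d.eval = ∑ i, (ω.deriv (b i)).eval ∘ₗ pointwise (retVec (b i)) := by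
    refine dirac_lhom_ext fun p m v => ?_
    rw [eval_single_ιMulti]
    simp only [LinearMap.sum_apply, LinearMap.comp_apply, pointwise_single, eval_single]
    cases m with
    | zero =>
      have h : ∀ x : V, retVec x (1 : ExteriorAlgebra ℝ V) = 0 := fun x =>
        CliffordAlgebra.contractLeft_one _ (innerₗ V x)
      simp [h, Form.d]
    | succ m =>
      simp only [retVec_ιMulti, map_sum, map_smul, val_ιMulti, smul_eq_mul]
      rw [Finset.sum_comm]
      simp only [Form.d, extDeriv, ContinuousAlternatingMap.alternatizeUncurryFin_apply]
      refine Finset.sum_congr rfl fun j _ => ?_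
      -- The `j`-th term of `d` differentiates along `v j`. Expanding `v j` in the basis turns this
      -- into the coefficients `⟨e_i, v j⟩` produced by retraction.
      conv_lhs => rw [← b.sum_repr' (v j)]
      simp only [map_sum, map_smul, ContinuousAlternatingMap.sum_apply,
        ContinuousAlternatingMap.smul_apply, Finset.smul_sum, Form.deriv, smul_eq_mul, mul_assoc]
      simp
  rw [this]
  simp

theorem Form.isB_sum {ι : Type*} (s : Finset ι) {r : ℕ} {ω : Form V} {η : ι → Form V}
    (hη : ∀ i, (η i).IsB r) {f : ι → ExteriorAlgebra ℝ V →ₗ[ℝ] ExteriorAlgebra ℝ V}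
    (h : ∀ A, ω.eval A = ∑ i ∈ s, (η i).eval (pointwise (f i) A)) : ω.IsB r := by
  refine ⟨‖∑ i ∈ s, (integralL (hη i)).comp (pointwiseL (f i) r)‖, fun A => ?_⟩
  rw [h, ← norm_ofDirac r A]
  refine le_trans (le_of_eq ?_)
    ((∑ i ∈ s, (integralL (hη i)).comp (pointwiseL (f i) r)).le_opNorm _)
  rw [_root_.sum_apply]
  congr 1
  refine Finset.sum_congr rfl fun i _ => ?_
  rw [ContinuousLinearMap.comp_apply, pointwiseL_ofDirac, ← integral_eq, integral_ofDirac (hη i)]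

theorem Form.IsB.d (b : OrthonormalBasis (Fin n) ℝ V) {r : ℕ} (hr : 1 ≤ r) {ω : Form V}
    (hω : ω.IsB (r + 1)) : ω.d.IsB r :=
  Form.isB_sum Finset.univ (fun i => hω.deriv (b i) hr) (Form.eval_d b ω)

theorem bdry_eq (b : OrthonormalBasis (Fin n) ℝ V) {r : ℕ} (hr : 1 ≤ r) (J : Chain V r) :
    bdry b J = ∑ i, prederivL (b i) hr (pointwiseL (retVec (b i)) r J) := rfl

theorem integral_bdry (b : OrthonormalBasis (Fin n) ℝ V) {r : ℕ} (hr : 1 ≤ r) {ω : Form V}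
    (hω : ω.IsB (r + 1)) (J : Chain V r) : integral (bdry b J) ω = integral J ω.d := by
  have hd := hω.d b hr
  rw [bdry_eq b hr, integral_eq hω, map_sum]
  simp only [← integral_eq hω, integral_prederivL _ hr hω]
  refine congrFun (chain_ext
    (f := fun J => ∑ i, integral (pointwiseL (retVec (b i)) r J) (ω.deriv (b i)))
    (g := fun J => integral J ω.d) (continuous_finsetSum _ fun i _ =>
      (integralL (hω.deriv (b i) hr)).continuous.comp (pointwiseL _ r).continuous)
    (integralL hd).continuous fun A => ?_) J
  rw [integral_ofDirac hd, Form.eval_d b]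
  refine Finset.sum_congr rfl fun i _ => ?_
  rw [pointwiseL_ofDirac, integral_ofDirac (hω.deriv (b i) hr)]

/-! ### Perpendicular complement, coboundary, Laplace operator -/

theorem perp_eq (b : OrthonormalBasis (Fin n) ℝ V) {r : ℕ} (J : Chain V r) :
    perp b J = pointwiseL (perpVec b) r J := by
  -- The accumulator is generalised to an arbitrary pointwise action so that the induction over the
  -- fold closes.
  have h : ∀ (l : List V) (f : ExteriorAlgebra ℝ V →ₗ[ℝ] ExteriorAlgebra ℝ V),
      l.foldl (fun K v => extrude v K + retract v K) (pointwiseL f r J) =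
      pointwiseL (l.foldl (fun f v => (extVec v + retVec v) ∘ₗ f) f) r J := by
    intro l
    induction l with
    | nil => intro f; rfl
    | cons v l ih =>
      intro f
      rw [List.foldl_cons, List.foldl_cons, ← ih, pointwiseL_comp, pointwiseL_add]
      rfl
  have h1 := h (List.ofFn b) LinearMap.id
  rw [pointwiseL_id] at h1
  exact h1

omit [FiniteDimensional ℝ V] in
theorem Form.eval_star (b : OrthonormalBasis (Fin n) ℝ V) (ω : Form V) (A : Dirac V) :
    (ω.star b).eval A = ω.eval (pointwise (perpVec b) A) := by
  have : (ω.star b).eval = ω.eval ∘ₗ pointwise (perpVec b) := by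
    refine dirac_lhom_ext fun p m v => ?_
    rw [eval_single_ιMulti, LinearMap.comp_apply, pointwise_single, eval_single]
    rfl
  rw [this, LinearMap.comp_apply]

theorem Form.IsB.star (b : OrthonormalBasis (Fin n) ℝ V) {r : ℕ} {ω : Form V}
    (hω : ω.IsB r) : (ω.star b).IsB r :=
  Form.isB_of_eval_comp_pointwise hω (Form.eval_star b ω)

theorem integral_perp (b : OrthonormalBasis (Fin n) ℝ V) {r : ℕ} {ω : Form V}
    (hω : ω.IsB r) (J : Chain V r) : integral (perp b J) ω = integral J (ω.star b) := by
  rw [perp_eq]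
  exact integral_pointwiseL hω (Form.eval_star b ω) J

theorem Form.IsB.codiff (b : OrthonormalBasis (Fin n) ℝ V) {r : ℕ} (hr : 1 ≤ r) {ω : Form V}
    (hω : ω.IsB (r + 1)) : (ω.codiff b).IsB r :=
  ((hω.star b).d b hr).star b

theorem integral_cobdry (b : OrthonormalBasis (Fin n) ℝ V) {r : ℕ} (hr : 1 ≤ r) {ω : Form V}
    (hω : ω.IsB (r + 1)) (J : Chain V r) :
    integral (cobdry b J) ω = integral J (ω.codiff b) := by
  rw [cobdry, integral_perp b hω, integral_bdry b hr (hω.star b),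
    integral_perp b ((hω.star b).d b hr)]
  rfl

theorem Form.IsB.lap (b : OrthonormalBasis (Fin n) ℝ V) {r : ℕ} (hr : 1 ≤ r) {ω : Form V}
    (hω : ω.IsB (r + 2)) : (ω.lap b).IsB r :=
  ((hω.codiff b (Nat.le_succ_of_le hr)).d b hr).add
    ((hω.d b (Nat.le_succ_of_le hr)).codiff b hr)

theorem integral_box (b : OrthonormalBasis (Fin n) ℝ V) {r : ℕ} (hr : 1 ≤ r) {ω : Form V}
    (hω : ω.IsB (r + 2)) (J : Chain V r) : integral (box b J) ω = integral J (ω.lap b) := by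
  have hr' : 1 ≤ r + 1 := Nat.le_succ_of_le hr
  have h1 : (ω.codiff b).IsB (r + 1) := hω.codiff b hr'
  have h2 : ω.d.IsB (r + 1) := hω.d b hr'
  rw [box, integral_eq hω, map_add, ← integral_eq hω, ← integral_eq hω,
    integral_cobdry b hr' hω, integral_bdry b hr' hω, integral_bdry b hr h1,
    integral_cobdry b hr h2, Form.lap, integral_add_form (h1.d b hr) (h2.codiff b hr)]

end Forms

/-! ### Clifford algebra and the sign, Laplacians as sums of squares, the inductive limit, and the
theorem. -/

section Divergence

variable {V : Type*} [NormedAddCommGroup V] [InnerProductSpace ℝ V] {n : ℕ}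

/-! ### Products of anticommuting elements -/

section Anticommuting

variable {R ι : Type*} [Ring R] [Algebra ℝ R] {c : ι → R}

theorem prod_mul_of_anticommute {x : R} {l : List ι} (h : ∀ w ∈ l, c w * x = -(x * c w)) :
    (l.map c).prod * x = (-1 : ℝ) ^ l.length • (x * (l.map c).prod) := by
  induction l with
  | nil => simp
  | cons w l ih =>
    rw [List.map_cons, List.prod_cons, mul_assoc, ih fun z hz => h z (by simp [hz]),
      mul_smul_comm, ← mul_assoc, h w (by simp), List.length_cons, pow_succ, mul_smul]
    simp [mul_assoc]

/-- Compared with an element anticommuting with every factor, one sign is lost when `c u` passes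
itself. -/
theorem prod_mul_of_mem {l : List ι} (h : l.Pairwise fun w z => c w * c z = -(c z * c w)) {u : ι}
    (hu : u ∈ l) :
    (l.map c).prod * c u = -(-1 : ℝ) ^ l.length • (c u * (l.map c).prod) := by
  induction l with
  | nil => simp at hu
  | cons w l ih =>
    rw [List.pairwise_cons] at h
    rw [List.map_cons, List.prod_cons, mul_assoc, List.length_cons, pow_succ]
    rcases List.mem_cons.1 hu with rfl | hu
    · rw [prod_mul_of_anticommute fun z hz => by rw [h.1 z hz, neg_neg], mul_smul_comm]
      simp
    · rw [ih h.2 hu, mul_smul_comm, ← mul_assoc, h.1 u hu]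
      simp [mul_assoc]

theorem prod_mul_self {l : List ι} (h : l.Pairwise fun w z => c w * c z = -(c z * c w))
    (h1 : ∀ w ∈ l, c w * c w = 1) :
    (l.map c).prod * (l.map c).prod = (-1 : ℝ) ^ (l.length * (l.length - 1) / 2) • (1 : R) := by
  induction l with
  | nil => simp
  | cons w l ih =>
    rw [List.pairwise_cons] at h
    have h2 : (l.map c).prod * c w = (-1 : ℝ) ^ l.length • (c w * (l.map c).prod) :=
      prod_mul_of_anticommute fun z hz => by rw [h.1 z hz, neg_neg]
    have h3 : (l.length + 1) * (l.length + 1 - 1) / 2 =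
        l.length + l.length * (l.length - 1) / 2 := by
      rw [Nat.triangle_succ, add_comm]
    rw [List.map_cons, List.prod_cons, List.length_cons, h3, mul_assoc, ← mul_assoc _ (c w), h2,
      smul_mul_assoc, mul_smul_comm, mul_assoc (c w), ← mul_assoc (c w), h1 w (by simp), one_mul,
      ih h.2 fun z hz => h1 z (by simp [hz]), smul_smul, pow_add]

end Anticommuting

/-! ### The Clifford relations -/

theorem extVec_comp (v w : V) : extVec v ∘ₗ extVec w = -(extVec w ∘ₗ extVec v) := by
  refine LinearMap.ext fun α => ?_
  have := congrArg (fun x : ExteriorAlgebra ℝ V => x * α) (ExteriorAlgebra.ι_add_mul_swap (R := ℝ) v w)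
  simp only [add_mul, zero_mul, mul_assoc] at this
  exact eq_neg_of_add_eq_zero_left this

theorem retVec_comp (v w : V) : retVec v ∘ₗ retVec w = -(retVec w ∘ₗ retVec v) := by
  refine LinearMap.ext fun α => ?_
  exact CliffordAlgebra.contractLeft_comm (innerₗ V v) (innerₗ V w) α

theorem retVec_comp_extVec (v w : V) :
    retVec v ∘ₗ extVec w = (inner ℝ v w : ℝ) • LinearMap.id - extVec w ∘ₗ retVec v := by
  refine LinearMap.ext fun α => ?_
  exact CliffordAlgebra.contractLeft_ι_mul (innerₗ V v) w α

/-- Clifford multiplication `C_v = E_v + E_v†`. -/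
def cliff (v : V) : Module.End ℝ (ExteriorAlgebra ℝ V) := extVec v + retVec v

theorem cliff_mul (v w : V) :
    cliff v * cliff w = (2 * inner ℝ v w : ℝ) • 1 - cliff w * cliff v := by
  have h1 : extVec v * extVec w = -(extVec w * extVec v) := extVec_comp v w
  have h2 : retVec v * retVec w = -(retVec w * retVec v) := retVec_comp v w
  have h3 : retVec v * extVec w = (inner ℝ v w : ℝ) • 1 - extVec w * retVec v :=
    retVec_comp_extVec v w
  have h4 : retVec w * extVec v = (inner ℝ v w : ℝ) • 1 - extVec v * retVec w := by
    rw [real_inner_comm]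
    exact retVec_comp_extVec w v
  simp only [cliff, add_mul, mul_add, h1, h2, h3, h4, two_mul, add_smul]
  abel

/-- The two mixed anticommutators contribute `⟨v, w⟩` with opposite signs and cancel, even when `v =
w`. -/
theorem cliff_mul_sub (v w : V) :
    cliff v * (extVec w - retVec w) = -((extVec w - retVec w) * cliff v) := by
  have h1 : extVec v * extVec w = -(extVec w * extVec v) := extVec_comp v w
  have h2 : retVec v * retVec w = -(retVec w * retVec v) := retVec_comp v w
  have h3 : retVec v * extVec w = (inner ℝ v w : ℝ) • 1 - extVec w * retVec v :=
    retVec_comp_extVec v w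
  have h4 : retVec w * extVec v = (inner ℝ v w : ℝ) • 1 - extVec v * retVec w := by
    rw [real_inner_comm]
    exact retVec_comp_extVec w v
  simp only [cliff, add_mul, mul_sub, sub_mul, mul_add, h1, h2, h3, h4]
  abel

theorem perpVec_eq_prod (b : OrthonormalBasis (Fin n) ℝ V) :
    perpVec b = ((List.ofFn b).reverse.map cliff).prod := by
  have h : ∀ (l : List V) (f : Module.End ℝ (ExteriorAlgebra ℝ V)),
      l.foldl (fun f v => (extVec v + retVec v) ∘ₗ f) f = (l.reverse.map cliff).prod * f := by
    intro l
    induction l with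
    | nil => intro f; simp
    | cons v l ih =>
      intro f
      rw [List.foldl_cons, ih, List.reverse_cons, List.map_append, List.prod_append, mul_assoc]
      simp only [List.map_cons, List.map_nil, List.prod_cons, List.prod_nil, mul_one]
      rfl
  have := h (List.ofFn b) 1
  rw [mul_one] at this
  exact this

/-- The sign relating the Laplace operators to the sum of the second derivatives. -/
def lapSign (n : ℕ) : ℝ := (-1) ^ (n * (n + 1) / 2 + 1)

/-- Split `E_i† = (C_i - D_i)/2` with `D_i = E_i - E_i†`. Passing through `⊥`, `D_i` picks up
`(-1)^n` and `C_i` picks up `-(-1)^n`, so the difference becomes the sum `C_i + D_i = 2 E_i`. The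
remaining `⊥²` is `(-1)^(n(n-1)/2)`. -/
theorem perpVec_conj_retVec (b : OrthonormalBasis (Fin n) ℝ V) (i : Fin n) :
    perpVec b ∘ₗ retVec (b i) ∘ₗ perpVec b = lapSign n • extVec (b i) := by
  set l := (List.ofFn b).reverse with hl
  have hlen : l.length = n := by simp [hl]
  have hpair : l.Pairwise fun w z => cliff w * cliff z = -(cliff z * cliff w) := by
    rw [hl, List.pairwise_reverse, List.pairwise_ofFn]
    intro i j hij
    rw [cliff_mul, b.orthonormal.2 hij.ne']
    simp
  have hsq : ∀ w ∈ l, cliff w * cliff w = 1 := by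
    intro w hw
    obtain ⟨j, rfl⟩ : ∃ j, b j = w := by simpa [hl, List.mem_ofFn] using hw
    have h := cliff_mul (b j) (b j)
    rw [real_inner_self_eq_norm_sq, b.norm_eq_one, eq_sub_iff_add_eq, ← two_smul ℝ (_ * _)] at h
    have h2 := congrArg (fun x => (2 : ℝ)⁻¹ • x) h
    simpa [smul_smul] using h2
  have hmem : b i ∈ l := by simp [hl, List.mem_ofFn]
  have h1 := prod_mul_of_mem hpair hmem
  have h2 := prod_mul_of_anticommute (c := cliff) (x := extVec (b i) - retVec (b i)) (l := l)
    fun w _ => cliff_mul_sub w (b i)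
  have h3 := prod_mul_self hpair hsq
  rw [← perpVec_eq_prod, hlen] at h1 h2 h3
  have h4 : perpVec b * retVec (b i) = -(-1 : ℝ) ^ n • (extVec (b i) * perpVec b) := by
    have h5 : retVec (b i) = (2 : ℝ)⁻¹ • (cliff (b i) - (extVec (b i) - retVec (b i))) := by
      rw [cliff]
      module
    have h6 : extVec (b i) = (2 : ℝ)⁻¹ • (cliff (b i) + (extVec (b i) - retVec (b i))) := by
      rw [cliff]
      module
    conv_lhs => rw [h5, mul_smul_comm, mul_sub, h1, h2]
    conv_rhs => rw [h6, smul_mul_assoc, add_mul]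
    module
  change perpVec b * (retVec (b i) * perpVec b) = _
  rw [← mul_assoc, h4, smul_mul_assoc, mul_assoc, h3, mul_smul_comm, mul_one, smul_smul]
  congr 1
  have h7 : n * (n + 1) / 2 = n * (n - 1) / 2 + n := by
    rw [mul_comm]
    exact Nat.triangle_succ n
  rw [lapSign, h7, pow_succ, pow_add]
  ring

/-! ### The Laplace operators as sums of second derivatives -/

section Laplace

variable [FiniteDimensional ℝ V]

theorem cobdry_eq (b : OrthonormalBasis (Fin n) ℝ V) {r : ℕ} (hr : 1 ≤ r) (J : Chain V r) :
    cobdry b J = lapSign n • ∑ i, prederivL (b i) hr (pointwiseL (extVec (b i)) r J) := by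
  rw [cobdry, perp_eq, perp_eq, bdry_eq b hr, map_sum, Finset.smul_sum]
  refine Finset.sum_congr rfl fun i _ => ?_
  rw [pointwiseL_prederivL, ← pointwiseL_comp, ← pointwiseL_comp, LinearMap.comp_assoc,
    perpVec_conj_retVec,
    pointwiseL_smul, map_smul]

/-- Up to the sign, `□` is the double sum of `P_i P_j (E_i E_j† + E_i† E_j)`. Since `E_i† E_j =
⟨e_i, e_j⟩ - E_j E_i†`, exchanging `i` and `j` and commuting the prederivatives cancels the terms in
`E` and `E†`. -/
theorem box_eq (b : OrthonormalBasis (Fin n) ℝ V) {r : ℕ} (hr : 1 ≤ r) (J : Chain V r) :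
    box b J = lapSign n •
      ∑ i, prederivL (b i) (Nat.le_succ_of_le hr) (prederivL (b i) hr J) := by
  have hr' : 1 ≤ r + 1 := Nat.le_succ_of_le hr
  have h1 : cobdry b (bdry b J) = lapSign n • ∑ i, ∑ j, prederivL (b i) hr'
      (prederivL (b j) hr (pointwiseL (extVec (b i)) r (pointwiseL (retVec (b j)) r J))) := by
    rw [cobdry_eq b hr', bdry_eq b hr]
    simp only [map_sum, pointwiseL_prederivL]
  have h2 : bdry b (cobdry b J) = lapSign n • ∑ i, ∑ j, prederivL (b i) hr'
      (prederivL (b j) hr (pointwiseL (retVec (b i)) r (pointwiseL (extVec (b j)) r J))) := by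
    rw [bdry_eq b hr', cobdry_eq b hr]
    simp only [map_sum, map_smul, pointwiseL_prederivL, Finset.smul_sum]
  have h3 : ∀ i j, pointwiseL (retVec (b i)) r (pointwiseL (extVec (b j)) r J) =
      (inner ℝ (b i) (b j) : ℝ) • J -
        pointwiseL (extVec (b j)) r (pointwiseL (retVec (b i)) r J) := by
    intro i j
    rw [← pointwiseL_comp, ← pointwiseL_comp, retVec_comp_extVec, sub_eq_add_neg,
      ← neg_one_smul ℝ (_ ∘ₗ _), pointwiseL_add, pointwiseL_smul, pointwiseL_smul, pointwiseL_id,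
      neg_one_smul, sub_eq_add_neg]
  rw [box, h1, h2, ← smul_add]
  congr 1
  have h4 : ∑ i, ∑ j, prederivL (b i) hr'
      (prederivL (b j) hr (pointwiseL (extVec (b j)) r (pointwiseL (retVec (b i)) r J))) =
      ∑ i, ∑ j, prederivL (b i) hr'
        (prederivL (b j) hr (pointwiseL (extVec (b i)) r (pointwiseL (retVec (b j)) r J))) := by
    rw [Finset.sum_comm]
    exact Finset.sum_congr rfl fun j _ => Finset.sum_congr rfl fun i _ => prederivL_comm _ _ hr _
  simp only [h3, map_sub, map_smul, Finset.sum_sub_distrib]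
  rw [h4, add_sub_cancel]
  refine Finset.sum_congr rfl fun i _ => ?_
  simp [b.inner_eq_ite]

theorem Form.lap_eq (b : OrthonormalBasis (Fin n) ℝ V) {r : ℕ} (hr : 1 ≤ r) {ω : Form V}
    (hω : ω.IsB (r + 2)) : ω.lap b = lapSign n • ∑ i, (ω.deriv (b i)).deriv (b i) := by
  have hr' : 1 ≤ r + 1 := Nat.le_succ_of_le hr
  refine Form.eval_injective (LinearMap.ext fun A => ?_)
  rw [← integral_ofDirac (hω.lap b hr), ← integral_box b hr hω, box_eq b hr, integral_eq hω,
    map_smul, map_sum, Form.eval_smul, Form.eval_sum, LinearMap.smul_apply, LinearMap.sum_apply]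
  congr 1
  refine Finset.sum_congr rfl fun i _ => ?_
  have h1 := hω.deriv (b i) hr'
  rw [← integral_eq hω, integral_prederivL _ hr' hω, integral_prederivL _ hr h1,
    integral_ofDirac (h1.deriv (b i) hr)]

theorem Form.lap_mem_formDeg (b : OrthonormalBasis (Fin n) ℝ V) {k r : ℕ} (hr : 1 ≤ r) {ω : Form V}
    (hω : ω ∈ formDeg V k ((r + 2 : ℕ) : ℕ∞)) : ω.lap b ∈ formDeg V k (r : ℕ∞) := by
  rw [mem_formDeg_natCast] at hω ⊢
  refine ⟨fun j hj => ?_, hω.2.lap b hr⟩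
  rw [Form.lap_eq b hr hω.2]
  have h : ∀ v, ω.deriv v j = 0 := fun v => by
    funext p
    simp [Form.deriv, hω.1 j hj]
  have h' : ∀ v, (ω.deriv v).deriv v j = 0 := fun v => by
    funext p
    rw [Form.deriv, h]
    simp
  simp [h']

-- The derivative is the finite sum of the rank-one maps `⟨e_j, ·⟩ ∂_j f`, so it inherits
-- differentiability from the partial derivatives.
omit [FiniteDimensional ℝ V] in
theorem differentiableAt_fderiv {F : Type*} [NormedAddCommGroup F] [NormedSpace ℝ F]
    (b : OrthonormalBasis (Fin n) ℝ V) {f : V → F} {p : V}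
    (h : ∀ j, DifferentiableAt ℝ (fun q => fderiv ℝ f q (b j)) p) :
    DifferentiableAt ℝ (fderiv ℝ f) p := by
  have h1 : fderiv ℝ f = fun q => ∑ j, ContinuousLinearMap.smulRightL ℝ V F (innerSL ℝ (b j))
      (fderiv ℝ f q (b j)) := by
    funext q
    refine ContinuousLinearMap.ext fun v => ?_
    conv_lhs => rw [← b.sum_repr' v]
    simp
  rw [h1]
  exact DifferentiableAt.fun_sum fun j _ => (ContinuousLinearMap.differentiableAt _).comp p (h j)

theorem Form.lap_eq_laplacian (b : OrthonormalBasis (Fin n) ℝ V) {ω : Form V} (hω : ω.IsB 3)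
    (k : ℕ) : ω.lap b k =
      lapSign n • (Laplacian.laplacian (ω k) : V → V [⋀^Fin k]→L[ℝ] ℝ) := by
  rw [Form.lap_eq b le_rfl hω, InnerProductSpace.laplacian_eq_iteratedFDeriv_orthonormalBasis _ b]
  funext p
  simp only [Pi.smul_apply, Finset.sum_apply, iteratedFDeriv_two_apply, Matrix.cons_val_zero,
    Matrix.cons_val_one]
  congr 1
  refine Finset.sum_congr rfl fun i _ => ?_
  -- Class `B^3` is what is used here: each `∂_j ω` is then of class `B^2`, hence differentiable.
  have hd : DifferentiableAt ℝ (fderiv ℝ (ω k)) p := differentiableAt_fderiv b fun j =>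
    Form.differentiable (hω.deriv (b j) one_le_two) k p
  change fderiv ℝ (fun q => fderiv ℝ (ω k) q (b i)) p (b i) = _
  rw [fderiv_clm_apply hd (differentiableAt_const _)]
  simp

theorem box_mem_chainSub (b : OrthonormalBasis (Fin n) ℝ V) {k r : ℕ} (hr : 1 ≤ r) {J : Chain V r}
    (hJ : J ∈ chainSub V k r) : box b J ∈ chainSub V k (r + 2) := by
  rw [box_eq b hr]
  exact Submodule.smul_mem _ _ (Submodule.sum_mem _ fun i _ =>
    prederivL_mem_chainSub _ _ (prederivL_mem_chainSub _ _ hJ))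

theorem link_box (b : OrthonormalBasis (Fin n) ℝ V) {r s : ℕ} (hr : 1 ≤ r) (h : r ≤ s)
    (J : Chain V r) :
    link V (r + 2) (s + 2) (by omega) (box b J) = box b (link V r s h J) := by
  rw [box_eq b hr, box_eq b (hr.trans h), map_smul, map_sum]
  congr 1
  refine Finset.sum_congr rfl fun i _ => ?_
  rw [link_prederivL _ _ (by omega : r + 1 ≤ s + 1), link_prederivL _ hr h]

end Laplace

/-! ### The inductive limit -/

instance directedSystem_link : DirectedSystem (Chain V) fun i j h => link V i j h where
  map_self i J := congrFun (chain_ext (continuous_link i i le_rfl) continuous_id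
    fun A => link_ofDirac i i le_rfl A) J
  map_map k j i hij hjk J := congrFun (chain_ext (f := fun J => link V j k hjk (link V i j hij J))
    ((continuous_link j k hjk).comp (continuous_link i j hij))
    (continuous_link i k (hij.trans hjk)) fun A => by simp only [link_ofDirac]) J

theorem toInf_link {r s : ℕ} (h : r ≤ s) (J : Chain V r) :
    toInf V s (link V r s h J) = toInf V r J :=
  Module.DirectLimit.of_f

/-- Makes the arbitrary choice in `rep` harmless: two representatives agree at some finite stage. -/
theorem exists_link_eq {r s : ℕ} {J : Chain V r} {K : Chain V s} (h : toInf V r J = toInf V s K) :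
    ∃ (t : ℕ) (hr : r ≤ t) (hs : s ≤ t), link V r t hr J = link V s t hs K := by
  rw [← toInf_link (le_max_left r s), ← toInf_link (le_max_right r s)] at h
  obtain ⟨t, ht, h⟩ := Module.DirectLimit.exists_eq_of_of_eq h
  refine ⟨t, (le_max_left r s).trans ht, (le_max_right r s).trans ht, ?_⟩
  have hm := fun (i : ℕ) (hi : i ≤ max r s) (L : Chain V i) =>
    DirectedSystem.map_map' (link V) hi ht L
  rw [← hm r (le_max_left r s), ← hm s (le_max_right r s)]
  exact h

theorem toInf_rep (J : ChainInf V) : toInf V ((rep J).1 + 1) (rep J).2 = J :=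
  (exists_rep J).choose_spec

theorem integralInf_toInf {ω : Form V} (hω : ∀ r, ω.IsB r) {r : ℕ} (K : Chain V r) :
    integralInf (toInf V r K) ω = integral K ω := by
  obtain ⟨t, h1, h2, h⟩ := exists_link_eq (toInf_rep (toInf V r K))
  rw [integralInf, ← integral_link h1 (hω t), h, integral_link h2 (hω t)]

variable [FiniteDimensional ℝ V]

theorem boxInf_toInf (b : OrthonormalBasis (Fin n) ℝ V) {r : ℕ} (hr : 1 ≤ r) (K : Chain V r) :
    boxInf b (toInf V r K) = toInf V (r + 2) (box b K) := by
  obtain ⟨t, h1, h2, h⟩ := exists_link_eq (toInf_rep (toInf V r K))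
  rw [boxInf, ← toInf_link (Nat.add_le_add_right h1 2), link_box b (Nat.le_add_left 1 _) h1, h,
    ← link_box b hr h2, toInf_link]

theorem boxInf_mem_chainInfDeg (b : OrthonormalBasis (Fin n) ℝ V) {k : ℕ} {J : ChainInf V}
    (hJ : J ∈ chainInfDeg V k) : boxInf b J ∈ chainInfDeg V k := by
  obtain ⟨r, K, hK, rfl⟩ := Set.mem_iUnion.1 hJ
  -- The representative is moved up one class, since it may have class `0`, which `boxInf_toInf`
  -- excludes.
  rw [← toInf_link r.le_succ, boxInf_toInf b (Nat.le_add_left 1 r)]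
  exact Set.mem_iUnion.2 ⟨_, _, box_mem_chainSub b (Nat.le_add_left 1 r)
    (link_mem_chainSub r.le_succ hK), rfl⟩

theorem Form.lap_mem_formDeg_top (b : OrthonormalBasis (Fin n) ℝ V) {k : ℕ} {ω : Form V}
    (hω : ω ∈ formDeg V k ⊤) : ω.lap b ∈ formDeg V k ⊤ := by
  rw [mem_formDeg_top] at hω ⊢
  have h : ∀ r, ω.lap b ∈ formDeg V k ((r + 1 : ℕ) : ℕ∞) := fun r =>
    Form.lap_mem_formDeg b (Nat.le_add_left 1 r) (mem_formDeg_natCast.2 ⟨hω.1, hω.2 _⟩)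
  exact ⟨(mem_formDeg_natCast.1 (h 0)).1, fun r => (mem_formDeg_natCast.1 (h r)).2.mono r.le_succ⟩

theorem integralInf_boxInf (b : OrthonormalBasis (Fin n) ℝ V) {ω : Form V} (hω : ∀ r, ω.IsB r)
    (J : ChainInf V) : integralInf (boxInf b J) ω = integralInf J (ω.lap b) := by
  rw [boxInf, integralInf_toInf hω, integral_box b (Nat.le_add_left 1 _) (hω _)]
  rfl

/-! ### The divergence theorem -/

theorem boxPow_divergence (b : OrthonormalBasis (Fin n) ℝ V) (k s : ℕ) {r : ℕ} (hr : 1 ≤ r)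
    {J : Chain V r} (hJ : J ∈ chainDeg V k r) {ω : Form V}
    (hω : ω ∈ formDeg V k ((r + 2 * s : ℕ) : ℕ∞)) :
    boxPow b s J ∈ chainDeg V k (r + 2 * s) ∧ (Form.lap b)^[s] ω ∈ formDeg V k (r : ℕ∞) ∧
      integral (boxPow b s J) ω = integral J ((Form.lap b)^[s] ω) := by
  induction s generalizing ω with
  | zero => exact ⟨hJ, hω, rfl⟩
  | succ s ih =>
    have hrs : 1 ≤ r + 2 * s := hr.trans (Nat.le_add_right _ _)
    -- The hypothesis is applied to `Δω`: the powers of `□` grow on the outside, while those of `Δ`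
    -- grow on the inside.
    obtain ⟨h1, h2, h3⟩ := ih (Form.lap_mem_formDeg b hrs hω)
    refine ⟨box_mem_chainSub b hrs h1, h2, ?_⟩
    rw [Function.iterate_succ_apply, ← h3]
    exact integral_box b hrs (mem_formDeg_natCast.1 hω).2 _

theorem boxInf_divergence (b : OrthonormalBasis (Fin n) ℝ V) (k s : ℕ)
    {J : ChainInf V} (hJ : J ∈ chainInfDeg V k) {ω : Form V} (hω : ω ∈ formDeg V k ⊤) :
    (boxInf b)^[s] J ∈ chainInfDeg V k ∧ (Form.lap b)^[s] ω ∈ formDeg V k ⊤ ∧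
      integralInf ((boxInf b)^[s] J) ω = integralInf J ((Form.lap b)^[s] ω) := by
  induction s generalizing ω with
  | zero => exact ⟨hJ, hω, rfl⟩
  | succ s ih =>
    obtain ⟨h1, h2, h3⟩ := ih (Form.lap_mem_formDeg_top b hω)
    rw [Function.iterate_succ_apply' (boxInf b), Function.iterate_succ_apply (Form.lap b)]
    refine ⟨boxInf_mem_chainInfDeg b h1, h2, ?_⟩
    rw [← h3, integralInf_boxInf b (mem_formDeg_top.1 hω).2]

end Divergence

end DiffChain

end

theorem mainTheorem4 {V : Type*} [NormedAddCommGroup V] [InnerProductSpace ℝ V]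
    [FiniteDimensional ℝ V] {n : ℕ} (b : OrthonormalBasis (Fin n) ℝ V) (k s : ℕ) :
    (∀ r : ℕ, (1 ≤ r ∨ s = 0) →
      ∀ J ∈ DiffChain.chainDeg V k r,
      ∀ ω ∈ DiffChain.formDeg V k ((r + 2 * s : ℕ) : ℕ∞),
        DiffChain.boxPow b s J ∈ DiffChain.chainDeg V k (r + 2 * s) ∧
        (DiffChain.Form.lap b)^[s] ω ∈ DiffChain.formDeg V k (r : ℕ∞) ∧
        DiffChain.integral (DiffChain.boxPow b s J) ω =
          DiffChain.integral J ((DiffChain.Form.lap b)^[s] ω)) ∧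
    (∀ J ∈ DiffChain.chainInfDeg V k,
      ∀ ω ∈ DiffChain.formDeg V k ⊤,
        (DiffChain.boxInf b)^[s] J ∈ DiffChain.chainInfDeg V k ∧
        (DiffChain.Form.lap b)^[s] ω ∈ DiffChain.formDeg V k ⊤ ∧
        DiffChain.integralInf ((DiffChain.boxInf b)^[s] J) ω =
          DiffChain.integralInf J ((DiffChain.Form.lap b)^[s] ω)) ∧
    (∀ ω ∈ DiffChain.formDeg V k 3,
      DiffChain.Form.lap b ω k =
        (-1 : ℝ) ^ (n * (n + 1) / 2 + 1) •
          (Laplacian.laplacian (ω k) : V → V [⋀^Fin k]→L[ℝ] ℝ)) := by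
  refine ⟨fun r hr J hJ ω hω => ?_, fun J hJ ω hω => DiffChain.boxInf_divergence b k s hJ hω,
    fun ω hω => DiffChain.Form.lap_eq_laplacian b
      (DiffChain.mem_formDeg_natCast (r := 3).1 hω).2 k⟩
  rcases hr with hr | rfl
  · exact DiffChain.boxPow_divergence b k s hr hJ hω
  · exact ⟨hJ, hω, rfl⟩
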